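/- Let $G=(V,E,w)$ be a finite undirected graph (loops allowed) with positive edge weights $w:E\to(0,\infty)$, let $w(v)=\sum_{u\sim v}w(u,v)$ denote the weighted degree of a vertex $v$ (a loop at $v$ is counted once), and assume $w(v)>0$ for every $v\in V$. For a nonempty set $S\subseteq V$ let $$\phi_G(S)=\frac{w(E(S,\overline S))}{w(S)},$$ where $w(S)=\sum_{v\in S}w(v)$ and $w(E(S,\overline S))$ is the total weight of the edges joining a vertex of $S$ to a vertex outside $S$. For $1\le k\le |V|$ let $$\rho_G(k)=\min_{S_1,\dots,S_k}\ \max_{1\le i\le k}\phi_G(S_i),$$ where the minimum is over all collections of $k$ nonempty, pairwise disjoint subsets $S_1,\dots,S_k\subseteq V$. Let $\lambda_1\le\lambda_2\le\dots\le\lambda_{|V|}$ be the eigenvalues, counted with multiplicity, of the normalized Laplacian $I-D^{-1/2}AD^{-1/2}$, where $A$ is the weighted adjacency matrix and $D$ is the diagonal matrix of weighted degrees. **Theorem.** There is an absolute constant $C>0$ such that for every such weighted graph $G$ and every integer $k$ with $1\le k\le |V|$, $$\frac{\lambda_k}{2}\ \le\ \rho_G(k)\ \le\ C\,k^2\sqrt{\lambda_k}.$$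 -/

import Mathlib

universe u

/-- A finite undirected weighted graph on the vertex set `V`: the edges are the unordered pairs
`{x, y}` with `0 < weight x y`, and every vertex has positive weighted degree. Loops are
allowed; a loop contributes its weight once to the degree of its vertex and never crosses a cut. -/
structure WeightedGraph (V : Type u) [Fintype V] where
  /-- The weight of the pair `{x, y}`, zero when it is not an edge. -/
  weight : V → V → ℝ
  weight_symm : ∀ x y, weight x y = weight y x
  weight_nonneg : ∀ x y, 0 ≤ weight x y
  degree_pos : ∀ x, 0 < ∑ y, weight x y

namespace WeightedGraph

variable {V : Type u} [Fintype V]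

/-- The weighted degree `w(v) = ∑_{x ∼ v} w(v, x)`. -/
def degree (G : WeightedGraph V) (v : V) : ℝ :=
  ∑ x, G.weight v x

/-- The volume `w(S) = ∑_{v ∈ S} w(v)` of a set of vertices. -/
def vol (G : WeightedGraph V) (S : Finset V) : ℝ :=
  ∑ v ∈ S, G.degree v

variable [DecidableEq V]

/-- The total weight `w(E(S, Sᶜ))` of the edges with exactly one endpoint in `S`
(each such edge is counted once, from its endpoint in `S`). -/
def cutWeight (G : WeightedGraph V) (S : Finset V) : ℝ :=
  ∑ x ∈ S, ∑ y ∈ Sᶜ, G.weight x y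

/-- The expansion `φ_G(S) = w(E(S, Sᶜ)) / w(S)`, meaningful for nonempty `S`. -/
noncomputable def expansion (G : WeightedGraph V) (S : Finset V) : ℝ :=
  G.cutWeight S / G.vol S

/-- The families `S_1, …, S_k` of `k` pairwise disjoint nonempty sets of vertices. -/
def DisjointFamily (V : Type u) (k : ℕ) : Type u :=
  {S : Fin k → Finset V // (∀ i, (S i).Nonempty) ∧ Pairwise fun i j => Disjoint (S i) (S j)}

/-- The `k`-way expansion constant
`ρ_G(k) = min_{S_1, …, S_k} max_i φ_G(S_i)` over disjoint nonempty `S_1, …, S_k`.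
For `1 ≤ k ≤ |V|` the infimum and the supremum are over nonempty finite types,
so they are a minimum and a maximum. -/
noncomputable def kWayExpansion (G : WeightedGraph V) (k : ℕ) : ℝ :=
  ⨅ S : DisjointFamily V k, ⨆ i : Fin k, G.expansion (S.1 i)

/-- The weighted adjacency matrix `A`. -/
def adjMatrix (G : WeightedGraph V) : Matrix V V ℝ :=
  Matrix.of G.weight

/-- The diagonal matrix `D^{-1/2}`, where `D` is the diagonal matrix of the weighted degrees. -/
noncomputable def invSqrtDegMatrix (G : WeightedGraph V) : Matrix V V ℝ :=
  Matrix.diagonal fun v => (Real.sqrt (G.degree v))⁻¹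

/-- The normalized Laplacian `I - D^{-1/2} A D^{-1/2}`. -/
noncomputable def normLaplacian (G : WeightedGraph V) : Matrix V V ℝ :=
  1 - G.invSqrtDegMatrix * G.adjMatrix * G.invSqrtDegMatrix

theorem normLaplacian_isHermitian (G : WeightedGraph V) : G.normLaplacian.IsHermitian := by
  ext x y
  by_cases h : x = y
  · simp [h]
  · simp only [normLaplacian, invSqrtDegMatrix, adjMatrix, Matrix.conjTranspose_apply,
      Matrix.sub_apply, Matrix.mul_diagonal, Matrix.diagonal_mul, Matrix.of_apply,
      Matrix.one_apply_ne h, Matrix.one_apply_ne (Ne.symm h), star_trivial,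
      G.weight_symm y x]
    ring

/-- `λ_k`, the `k`-th smallest eigenvalue (counted with multiplicity, `1 ≤ k ≤ |V|`) of the
normalized Laplacian. `Matrix.IsHermitian.eigenvalues₀` lists the eigenvalues in decreasing
order with indices `0, …, |V| - 1`, so the `k`-th smallest has index `|V| - k`. -/
noncomputable def lam (G : WeightedGraph V) (k : ℕ) (h₁ : 1 ≤ k) (h₂ : k ≤ Fintype.card V) : ℝ :=
  G.normLaplacian_isHermitian.eigenvalues₀ ⟨Fintype.card V - k, by omega⟩

end WeightedGraph

/-! The lower bound is Courant–Fischer on the span of the indicators of the `S i`: an edge joining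
two of the sets costs `(α i - α j)² ≤ 2 α i² + 2 α j²`, so Rayleigh quotients on this span are at
most twice the largest expansion.

For the upper bound, the eigenvectors of the `k` smallest eigenvalues, divided by the square roots
of the degrees, give a map `F : V → ℝᵏ` that is isotropic for the degree measure and has Dirichlet
energy at most `k λ_k`. Its total mass `∑ d(u) ‖F u‖²` is `k`, but by isotropy vertices whose
directions `F u / ‖F u‖` are within `1/(2√k)` of each other carry mass at most `1 + 1/(2k)`. Hence a
partition of the directions into such pieces can be regrouped into `k` groups of mass at least
`1/2`. Cheeger's `ℓ¹` sweep is run on `‖F‖²` cut off sharply to each group.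

The cut-off costs `w(u,v) ‖F u‖ ‖F v‖` on each separated pair. A partition into pieces of diameter
`2R` can be chosen with total cost `O(√k/R)` times the weighted distances; for `R ~ 1/√k` this is
`O(k)` times the distance between directions, and multiplying by the norms turns it into `O(k) (‖F
u‖ + ‖F v‖) ‖F u - F v‖`. By Cauchy–Schwarz these terms sum to `O(k² √λ_k)`.

The partition is built by carving out superlevel sets of translated paraboloids, with centre and
level chosen by averaging. `exists_superlevel_cut_le` serves both this carving and the final sweep.
-/

/-! ### Layer-cake selection of a level -/

open MeasureTheory in
/-- Layer-cake argument: a comparison of `ℓ¹`-energy with the sum of maxima is inherited by some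
superlevel set. -/
theorem exists_superlevel_cut_le {V : Type*} (X : Finset V) (f : V → ℝ) (hf : ∀ u, 0 ≤ f u)
    (c e : V → V → ℝ) (hpos : ∃ u ∈ X, 0 < f u)
    (h : ∑ u ∈ X, ∑ v ∈ X, c u v * |f u - f v| ≤ ∑ u ∈ X, ∑ v ∈ X, e u v * max (f u) (f v)) :
    ∃ t : ℝ, 0 ≤ t ∧ (∃ u ∈ X, t < f u) ∧
      ∑ u ∈ X, ∑ v ∈ X, c u v * (if (t < f u ↔ t < f v) then 0 else 1) ≤
        ∑ u ∈ X, ∑ v ∈ X, e u v * (if t < f u ∨ t < f v then 1 else 0) := by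
  obtain ⟨u₀, hu₀, hmax⟩ := X.exists_max_image f (hpos.imp fun _ h => h.1)
  have hM : 0 < f u₀ := by
    obtain ⟨u, hu, hu'⟩ := hpos
    exact hu'.trans_le (hmax u hu)
  by_contra! hcon
  let s : ℝ → ℝ → ℝ := fun a t => if t < a then 1 else 0
  have hs' (a b d : ℝ) : IntervalIntegrable (s a) volume b d := by
    have : Antitone (s a) := by
      intro t t' htt
      simp only [s]
      split_ifs with h1 h2 <;> linarith
    exact this.intervalIntegrable
  have hs (a : ℝ) : IntervalIntegrable (s a) volume 0 (f u₀) := hs' a _ _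
  have hsi (a : ℝ) (h0 : 0 ≤ a) (h1 : a ≤ f u₀) : ∫ t in (0)..(f u₀), s a t = a := by
    have h2 : ∫ t in (0)..a, s a t = ∫ t in (0)..a, (1 : ℝ) := by
      apply intervalIntegral.integral_congr_ae
      have : ∀ᵐ t : ℝ, t ≠ a := by simp [ae_iff]
      filter_upwards [this] with t ht ht'
      rw [Set.uIoc_of_le h0] at ht'
      simp [s, lt_of_le_of_ne ht'.2 ht]
    have h3 : ∫ t in a..(f u₀), s a t = ∫ t in a..(f u₀), (0 : ℝ) := by
      apply intervalIntegral.integral_congr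
      intro t ht
      rw [Set.uIcc_of_le h1] at ht
      simp [s, ht.1]
    rw [← intervalIntegral.integral_add_adjacent_intervals (hs' a 0 a) (hs' a a (f u₀)), h2, h3]
    simp
  -- Cut minus budget at level `t`: exactly one endpoint is above `t` when `min ≤ t < max`. The
  -- contrary assumption makes `H` positive on `(0, max f)`, while its integral is the difference of
  -- the two sides of `h`.
  let H : ℝ → ℝ := fun t => ∑ u ∈ X, ∑ v ∈ X,
    (c u v * (s (max (f u) (f v)) t - s (min (f u) (f v)) t) - e u v * s (max (f u) (f v)) t)
  have hterm (u v : V) : IntervalIntegrable (fun t =>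
      c u v * (s (max (f u) (f v)) t - s (min (f u) (f v)) t) - e u v * s (max (f u) (f v)) t)
      volume 0 (f u₀) :=
    (((hs _).sub (hs _)).const_mul _).sub ((hs _).const_mul _)
  have hHint : IntervalIntegrable H volume 0 (f u₀) := by
    have := IntervalIntegrable.sum X (f := fun u t => ∑ v ∈ X,
      (c u v * (s (max (f u) (f v)) t - s (min (f u) (f v)) t) - e u v * s (max (f u) (f v)) t))
      (μ := volume) (a := 0) (b := f u₀) (fun u _ => by
        have := IntervalIntegrable.sum X (f := fun v t =>
          (c u v * (s (max (f u) (f v)) t - s (min (f u) (f v)) t)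
            - e u v * s (max (f u) (f v)) t))
          (μ := volume) (a := 0) (b := f u₀) (fun v _ => hterm u v)
        rwa [Finset.sum_fn] at this)
    rwa [Finset.sum_fn] at this
  have hHpos : ∀ t ∈ Set.Ioo 0 (f u₀), 0 < H t := by
    intro t ht
    have h1 := hcon t ht.1.le ⟨u₀, hu₀, ht.2⟩
    rw [← sub_pos, ← Finset.sum_sub_distrib] at h1
    refine h1.trans_eq (Finset.sum_congr rfl fun u _ => ?_)
    rw [← Finset.sum_sub_distrib]
    refine Finset.sum_congr rfl fun v _ => ?_
    simp only [s, lt_max_iff, lt_min_iff]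
    by_cases h1 : t < f u <;> by_cases h2 : t < f v <;> simp [h1, h2]
  have hlt := intervalIntegral.intervalIntegral_pos_of_pos_on hHint hHpos hM
  have heq : ∫ t in (0)..(f u₀), H t =
      ∑ u ∈ X, ∑ v ∈ X, (c u v * |f u - f v| - e u v * max (f u) (f v)) := by
    simp only [H]
    rw [intervalIntegral.integral_finsetSum]
    · refine Finset.sum_congr rfl fun u hu => ?_
      rw [intervalIntegral.integral_finsetSum]
      · refine Finset.sum_congr rfl fun v hv => ?_
        rw [intervalIntegral.integral_sub (((hs _).sub (hs _)).const_mul _) ((hs _).const_mul _),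
          intervalIntegral.integral_const_mul, intervalIntegral.integral_const_mul,
          intervalIntegral.integral_sub (hs _) (hs _),
          hsi _ (le_max_of_le_left (hf u)) (max_le (hmax u hu) (hmax v hv)),
          hsi _ (le_min (hf u) (hf v)) (min_le_of_left_le (hmax u hu)), max_sub_min_eq_abs']
      · exact fun v _ => hterm u v
    · intro u _
      have := IntervalIntegrable.sum X (f := fun v t =>
          (c u v * (s (max (f u) (f v)) t - s (min (f u) (f v)) t)
            - e u v * s (max (f u) (f v)) t))
          (μ := volume) (a := 0) (b := f u₀) (fun v _ => hterm u v)
      rwa [Finset.sum_fn] at this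
  rw [heq] at hlt
  simp only [Finset.sum_sub_distrib] at hlt
  linarith

/-! ### Integral estimates for the paraboloid bump -/

section Bump

open MeasureTheory Metric

variable {k : ℕ}

local notation "E" => EuclideanSpace ℝ (Fin k)

/-- The reflection exchanging `v` and `w` preserves both the ball and Lebesgue measure. -/
theorem integral_ball_inner_sq_eq (R : ℝ) (v w : EuclideanSpace ℝ (Fin k)) (h : ‖v‖ = ‖w‖) :
    ∫ a in ball (0 : EuclideanSpace ℝ (Fin k)) R, inner ℝ v a ^ 2 =
      ∫ a in ball (0 : EuclideanSpace ℝ (Fin k)) R, inner ℝ w a ^ 2 := by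
  let T : E ≃ₗᵢ[ℝ] E := (ℝ ∙ (v - w))ᗮ.reflection
  have hT : T v = w := Submodule.reflection_sub h
  have h1 := T.measurePreserving.setIntegral_preimage_emb T.toHomeomorph.measurableEmbedding
    (fun a => inner ℝ w a ^ 2) (ball 0 R)
  rw [← h1]
  have h2 : T ⁻¹' ball 0 R = ball 0 R := by ext; simp
  rw [h2]
  simp_rw [← hT, T.inner_map_map]

/-- By rotational symmetry every direction contributes equally, and the `k` coordinate directions
together give `‖a‖² ≤ R²`. -/
theorem integral_ball_inner_sq_le (hk : 0 < k) {R : ℝ} (v : EuclideanSpace ℝ (Fin k)) :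
    ∫ a in ball (0 : EuclideanSpace ℝ (Fin k)) R, inner ℝ v a ^ 2 ≤
      ‖v‖ ^ 2 * R ^ 2 * volume.real (ball (0 : EuclideanSpace ℝ (Fin k)) R) / k := by
  have hint (w : E) : IntegrableOn (fun a => inner ℝ w a ^ 2) (ball (0 : E) R) :=
    ((by fun_prop : Continuous fun a : E => inner ℝ w a ^ 2).continuousOn.integrableOn_compact
      (isCompact_closedBall (0 : E) R)).mono_set ball_subset_closedBall
  have h1 : (k : ℝ) * ∫ a in ball (0 : E) R, inner ℝ v a ^ 2 =
      ∫ a in ball (0 : E) R, ‖v‖ ^ 2 * ‖a‖ ^ 2 := by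
    calc (k : ℝ) * ∫ a in ball (0 : E) R, inner ℝ v a ^ 2
        = ∑ i : Fin k, ∫ a in ball (0 : E) R, inner ℝ v a ^ 2 := by simp
      _ = ∑ i : Fin k, ∫ a in ball (0 : E) R,
            inner ℝ (‖v‖ • EuclideanSpace.single i (1 : ℝ)) a ^ 2 := by
          refine Finset.sum_congr rfl fun i _ => integral_ball_inner_sq_eq R _ _ ?_
          simp [norm_smul]
      _ = ∫ a in ball (0 : E) R, ∑ i : Fin k,
            inner ℝ (‖v‖ • EuclideanSpace.single i (1 : ℝ)) a ^ 2 := by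
          rw [integral_finsetSum]
          exact fun i _ => hint _
      _ = _ := by
          refine integral_congr_ae (Filter.Eventually.of_forall fun a => ?_)
          simp [inner_smul_left, EuclideanSpace.inner_single_left, mul_pow, ← Finset.mul_sum,
            EuclideanSpace.norm_sq_eq]
  have h2 : ∫ a in ball (0 : E) R, ‖v‖ ^ 2 * ‖a‖ ^ 2 ≤
      ∫ a in ball (0 : E) R, ‖v‖ ^ 2 * R ^ 2 := by
    refine setIntegral_mono_on ?_ ?_ measurableSet_ball ?_
    · exact ((by fun_prop : Continuous fun a : E => ‖v‖ ^ 2 * ‖a‖ ^ 2).continuousOn.integrableOn_compact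
        (isCompact_closedBall (0 : E) R)).mono_set ball_subset_closedBall
    · exact integrableOn_const (measure_ball_lt_top.ne)
    · intro a ha
      have : ‖a‖ < R := by simpa using ha
      gcongr
  rw [setIntegral_const, smul_eq_mul] at h2
  have hk' : (0 : ℝ) < k := by exact_mod_cast hk
  rw [le_div_iff₀ hk']
  linarith

/-- The truncated paraboloid of radius `R`. -/
noncomputable def paraboloid {k : ℕ} (R : ℝ) (a : EuclideanSpace ℝ (Fin k)) : ℝ :=
  max 0 (1 - ‖a‖ ^ 2 / R ^ 2)

theorem paraboloid_nonneg (R : ℝ) (a : EuclideanSpace ℝ (Fin k)) : 0 ≤ paraboloid R a :=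
  le_max_left _ _

theorem continuous_paraboloid (R : ℝ) :
    Continuous (paraboloid R : EuclideanSpace ℝ (Fin k) → ℝ) := by
  unfold paraboloid; fun_prop

theorem paraboloid_pos_iff {R : ℝ} (hR : 0 < R) (a : EuclideanSpace ℝ (Fin k)) :
    0 < paraboloid R a ↔ ‖a‖ < R := by
  unfold paraboloid
  rw [lt_max_iff, sub_pos, div_lt_one (by positivity), sq_lt_sq₀ (norm_nonneg _) hR.le]
  simp

theorem paraboloid_eq_zero {R : ℝ} (hR : 0 < R) {a : EuclideanSpace ℝ (Fin k)} (h : R ≤ ‖a‖) :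
    paraboloid R a = 0 :=
  le_antisymm (not_lt.1 fun h' => h.not_gt ((paraboloid_pos_iff hR a).1 h'))
    (paraboloid_nonneg R a)

theorem hasCompactSupport_paraboloid {R : ℝ} (hR : 0 < R) :
    HasCompactSupport (paraboloid R : EuclideanSpace ℝ (Fin k) → ℝ) := by
  refine HasCompactSupport.intro (isCompact_closedBall (0 : E) R) fun a ha => ?_
  simp only [mem_closedBall, dist_zero_right, not_le] at ha
  exact paraboloid_eq_zero hR ha.le

theorem hasCompactSupport_paraboloid_sub {R : ℝ} (hR : 0 < R) (x : EuclideanSpace ℝ (Fin k)) :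
    HasCompactSupport fun z => paraboloid R (x - z) :=
  (hasCompactSupport_paraboloid hR).comp_homeomorph (Homeomorph.subLeft x)

theorem integrable_paraboloid {R : ℝ} (hR : 0 < R) :
    Integrable (paraboloid R : EuclideanSpace ℝ (Fin k) → ℝ) :=
  (continuous_paraboloid R).integrable_of_hasCompactSupport (hasCompactSupport_paraboloid hR)

/-- Shrinking the ball by the factor `1 - 1/(2k)` keeps half of its volume (Bernoulli), and there
the bump is at least `1/(2k)`. -/
theorem le_integral_paraboloid (hk : 0 < k) {R : ℝ} (hR : 0 < R) :
    volume.real (ball (0 : EuclideanSpace ℝ (Fin k)) R) / (4 * k) ≤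
      ∫ a : EuclideanSpace ℝ (Fin k), paraboloid R a := by
  have hk' : (1 : ℝ) ≤ k := by exact_mod_cast hk
  set r : ℝ := 1 - 1 / (2 * k) with hr
  have hx : 1 / (2 * (k : ℝ)) ≤ 1 / 2 := by
    apply one_div_le_one_div_of_le <;> linarith
  have hx0 : 0 < 1 / (2 * (k : ℝ)) := by positivity
  have hr0 : 0 < r := by rw [hr]; linarith
  have hpow : 1 / 2 ≤ r ^ k := by
    have := one_add_mul_le_pow (a := -(1 / (2 * (k : ℝ)))) (by linarith) k
    have h2 : (k : ℝ) * -(1 / (2 * (k : ℝ))) = -(1 / 2) := by field_simp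
    rw [h2] at this
    rw [hr, sub_eq_add_neg]
    linarith
  have hvol : volume.real (ball (0 : E) (r * R)) = r ^ k * volume.real (ball (0 : E) R) := by
    have := Measure.addHaar_ball_mul_of_pos (volume : Measure E) 0 hr0 R
    rw [Measure.real, this, ENNReal.toReal_mul, Measure.real,
      Measure.addHaar_ball_center (volume : Measure E) 0, finrank_euclideanSpace_fin,
      ENNReal.toReal_ofReal (by positivity)]
  calc volume.real (ball (0 : E) R) / (4 * k)
      ≤ 1 / (2 * k) * volume.real (ball (0 : E) (r * R)) := by
        rw [hvol]
        have h0 : 0 ≤ volume.real (ball (0 : E) R) := measureReal_nonneg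
        have : volume.real (ball (0 : E) R) / (4 * k) =
          1 / (2 * k) * (1 / 2 * volume.real (ball (0 : E) R)) := by field_simp; norm_num
        rw [this]
        gcongr
    _ = ∫ a in ball (0 : E) (r * R), (1 / (2 * k) : ℝ) := by
        rw [setIntegral_const, smul_eq_mul, mul_comm]
    _ ≤ ∫ a in ball (0 : E) (r * R), paraboloid R a := by
        refine setIntegral_mono_on (integrableOn_const measure_ball_lt_top.ne)
          (integrable_paraboloid hR).integrableOn measurableSet_ball fun a ha => ?_
        have ha' : ‖a‖ < r * R := by simpa using ha
        refine le_max_of_le_right ?_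
        have : ‖a‖ ^ 2 / R ^ 2 ≤ r ^ 2 := by
          rw [div_le_iff₀ (by positivity), ← mul_pow]
          gcongr
        rw [hr] at this
        nlinarith
    _ ≤ ∫ a : E, paraboloid R a :=
        setIntegral_le_integral (integrable_paraboloid hR)
          (Filter.Eventually.of_forall (paraboloid_nonneg R))

/-- Majorant of the change of the paraboloid between two points. -/
theorem abs_paraboloid_sub_le {R : ℝ} (hR : 0 < R) (a b : EuclideanSpace ℝ (Fin k)) :
    |paraboloid R a - paraboloid R b| ≤
      (ball 0 R).indicator (fun a' => (2 * |inner ℝ (a - b) a'| + ‖a - b‖ ^ 2) / R ^ 2) a +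
      (ball 0 R).indicator (fun a' => (2 * |inner ℝ (a - b) a'| + ‖a - b‖ ^ 2) / R ^ 2) b := by
  have hnn (a' : E) : 0 ≤ (ball (0 : E) R).indicator
      (fun a' => (2 * |inner ℝ (a - b) a'| + ‖a - b‖ ^ 2) / R ^ 2) a' :=
    Set.indicator_nonneg (fun _ _ => by positivity) _
  have key : |paraboloid R a - paraboloid R b| ≤ |‖a‖ ^ 2 - ‖b‖ ^ 2| / R ^ 2 := by
    unfold paraboloid
    rw [max_comm 0, max_comm 0]
    refine (abs_max_sub_max_le_abs _ _ _).trans_eq ?_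
    rw [sub_sub_sub_cancel_left, ← sub_div, abs_div, abs_sub_comm, abs_of_pos (sq_pos_of_pos hR)]
  -- The difference of squares is expanded about whichever point lies in the ball. Each majorant
  -- then depends on that point and the fixed vector `a - b` only, so translation invariance applies
  -- under the integral.
  by_cases ha : ‖a‖ < R
  · have h1 : ‖a‖ ^ 2 - ‖b‖ ^ 2 = 2 * inner ℝ (a - b) a - ‖a - b‖ ^ 2 := by
      rw [norm_sub_sq_real, inner_sub_left, real_inner_self_eq_norm_sq, real_inner_comm]; ring
    refine le_trans ?_ (le_add_of_nonneg_right (hnn b))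
    rw [Set.indicator_of_mem (by simpa using ha)]
    refine key.trans ?_
    gcongr
    rw [h1]
    refine (abs_sub _ _).trans ?_
    rw [abs_mul, abs_of_nonneg (sq_nonneg ‖a - b‖)]; simp
  by_cases hb : ‖b‖ < R
  · have h1 : ‖a‖ ^ 2 - ‖b‖ ^ 2 = 2 * inner ℝ (a - b) b + ‖a - b‖ ^ 2 := by
      rw [norm_sub_sq_real, inner_sub_left, real_inner_self_eq_norm_sq]; ring
    refine le_trans ?_ (le_add_of_nonneg_left (hnn a))
    rw [Set.indicator_of_mem (by simpa using hb)]
    refine key.trans ?_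
    gcongr
    rw [h1]
    refine (abs_add_le _ _).trans ?_
    rw [abs_mul, abs_of_nonneg (sq_nonneg ‖a - b‖)]; simp
  · rw [paraboloid_eq_zero hR (not_lt.1 ha), paraboloid_eq_zero hR (not_lt.1 hb)]
    simpa using add_nonneg (hnn a) (hnn b)

theorem integral_abs_inner_ball_le (hk : 0 < k) {R : ℝ} (hR : 0 < R)
    (v : EuclideanSpace ℝ (Fin k)) :
    ∫ a in ball (0 : EuclideanSpace ℝ (Fin k)) R, 2 * |inner ℝ v a| ≤
      2 * (‖v‖ * R / √k) * volume.real (ball (0 : EuclideanSpace ℝ (Fin k)) R) := by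
  have hk' : (0 : ℝ) < k := by exact_mod_cast hk
  rcases eq_or_ne v 0 with rfl | hv
  · simp
  have hv' : 0 < ‖v‖ := norm_pos_iff.2 hv
  -- `β` bounds the root mean square of `inner ℝ v a` over the ball; `2t ≤ t²/β + β` then does the
  -- work of Cauchy–Schwarz.
  set β := ‖v‖ * R / √k with hβ
  have hβ0 : 0 < β := by positivity
  have hint : IntegrableOn (fun a => inner ℝ v a ^ 2) (ball (0 : E) R) :=
    ((by fun_prop : Continuous fun a : E => inner ℝ v a ^ 2).continuousOn.integrableOn_compact
      (isCompact_closedBall (0 : E) R)).mono_set ball_subset_closedBall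
  have hint2 : IntegrableOn (fun a => 2 * |inner ℝ v a|) (ball (0 : E) R) :=
    ((by fun_prop : Continuous fun a : E => 2 * |inner ℝ v a|).continuousOn.integrableOn_compact
      (isCompact_closedBall (0 : E) R)).mono_set ball_subset_closedBall
  have hconst : IntegrableOn (fun _ : E => β) (ball (0 : E) R) :=
    integrableOn_const measure_ball_lt_top.ne
  calc ∫ a in ball (0 : E) R, 2 * |inner ℝ v a|
      ≤ ∫ a in ball (0 : E) R, (β⁻¹ * inner ℝ v a ^ 2 + β) := by
        refine integral_mono hint2 ((hint.const_mul _).add hconst) fun a => ?_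
        simp only
        have h1 : 0 ≤ β⁻¹ * (|inner ℝ v a| - β) ^ 2 := by positivity
        have h2 : β⁻¹ * (|inner ℝ v a| - β) ^ 2 =
          β⁻¹ * inner ℝ v a ^ 2 + β - 2 * |inner ℝ v a| := by
          rw [sub_sq, sq_abs]; field_simp; ring
        linarith
    _ = β⁻¹ * (∫ a in ball (0 : E) R, inner ℝ v a ^ 2) + β * volume.real (ball (0 : E) R) := by
        rw [integral_add (hint.const_mul _) hconst, integral_const_mul, setIntegral_const,
          smul_eq_mul, mul_comm β]
    _ ≤ β⁻¹ * (‖v‖ ^ 2 * R ^ 2 * volume.real (ball (0 : E) R) / k)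
          + β * volume.real (ball (0 : E) R) := by
        gcongr
        exact integral_ball_inner_sq_le hk v
    _ = _ := by
        have : ‖v‖ ^ 2 * R ^ 2 * volume.real (ball (0 : E) R) / k
            = β ^ 2 * volume.real (ball (0 : E) R) := by
          rw [hβ, div_pow, Real.sq_sqrt hk'.le]; ring
        rw [this]; field_simp; ring

/-- The gradient of `‖a‖²/R²` in a fixed direction averages `O(1/(R√k))` over the ball, while the
bump has mean at least `1/(4k)`: the ratio is of order `√k/R`, the rate at which a random carving
separates two points. -/
theorem integral_abs_paraboloid_sub_le (hk : 0 < k) {R : ℝ} (hR : 0 < R)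
    (x y : EuclideanSpace ℝ (Fin k)) :
    ∫ z, |paraboloid R (x - z) - paraboloid R (y - z)| ≤
      24 * √k / R * dist x y * ∫ z, max (paraboloid R (x - z)) (paraboloid R (y - z)) := by
  have hk' : (0 : ℝ) < k := by exact_mod_cast hk
  have hx (x : E) : Integrable fun z => paraboloid R (x - z) :=
    (integrable_paraboloid hR).comp_sub_left x
  have hmax : Integrable fun z => max (paraboloid R (x - z)) (paraboloid R (y - z)) :=
    (hx x).sup (hx y)
  have habs : Integrable fun z => |paraboloid R (x - z) - paraboloid R (y - z)| :=
    ((hx x).sub (hx y)).abs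
  set s := √k / R * dist x y with hs
  have hs' : 24 * √k / R * dist x y = 24 * s := by rw [hs]; ring
  rw [hs']
  have hs0 : 0 ≤ s := by positivity
  -- For `s ≤ 1` the quadratic term is absorbed by `s² ≤ s`; for `s > 1` the trivial bound `|a - b|
  -- ≤ max a b` for nonnegative reals suffices.
  rcases le_or_gt s 1 with h1 | h1
  · set q : E → ℝ := (ball (0 : E) R).indicator
      (fun a' => (2 * |inner ℝ (x - y) a'| + ‖x - y‖ ^ 2) / R ^ 2) with hq
    have hi1 : IntegrableOn (fun a => 2 * |inner ℝ (x - y) a|) (ball (0 : E) R) :=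
      ((by fun_prop : Continuous fun a : E =>
        2 * |inner ℝ (x - y) a|).continuousOn.integrableOn_compact
        (isCompact_closedBall (0 : E) R)).mono_set ball_subset_closedBall
    have hi2 : IntegrableOn (fun _ : E => ‖x - y‖ ^ 2) (ball (0 : E) R) :=
      integrableOn_const measure_ball_lt_top.ne
    have hqi : Integrable q := by
      rw [hq, integrable_indicator_iff measurableSet_ball]
      exact (hi1.add hi2).div_const _
    have hB0 : 0 ≤ volume.real (ball (0 : E) R) := measureReal_nonneg
    have hqle : ∫ a, q a ≤ (2 * s + s ^ 2) * volume.real (ball (0 : E) R) / k := by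
      rw [hq, integral_indicator measurableSet_ball, integral_div,
        integral_add hi1 hi2, setIntegral_const, smul_eq_mul]
      have h3 := integral_abs_inner_ball_le hk hR (x - y)
      rw [← dist_eq_norm] at h3 ⊢
      have hd : dist x y = s * R / √k := by rw [hs]; field_simp
      have h4 : (2 * (dist x y * R / √k) * volume.real (ball (0 : E) R)
        + volume.real (ball (0 : E) R) * dist x y ^ 2) / R ^ 2 =
          (2 * s + s ^ 2) * volume.real (ball (0 : E) R) / k := by
        rw [hd, div_pow, Real.sq_sqrt hk'.le, div_mul_eq_mul_div, div_div,
          Real.mul_self_sqrt hk'.le]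
        field_simp
      rw [← h4]
      gcongr
    calc ∫ z, |paraboloid R (x - z) - paraboloid R (y - z)|
        ≤ ∫ z, (q (x - z) + q (y - z)) := by
          refine integral_mono habs ((hqi.comp_sub_left x).add (hqi.comp_sub_left y)) fun z => ?_
          have := abs_paraboloid_sub_le hR (x - z) (y - z)
          rwa [sub_sub_sub_cancel_right] at this
      _ = 2 * ∫ a, q a := by
          rw [integral_add (hqi.comp_sub_left x) (hqi.comp_sub_left y),
            integral_sub_left_eq_self q, integral_sub_left_eq_self q]; ring
      _ ≤ 2 * ((2 * s + s ^ 2) * volume.real (ball (0 : E) R) / k) := by gcongr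
      _ ≤ 2 * ((3 * s) * volume.real (ball (0 : E) R) / k) := by gcongr; nlinarith
      _ = 24 * s * (volume.real (ball (0 : E) R) / (4 * k)) := by field_simp; ring
      _ ≤ 24 * s * ∫ a : E, paraboloid R a := by gcongr; exact le_integral_paraboloid hk hR
      _ = 24 * s * ∫ z, paraboloid R (x - z) := by rw [integral_sub_left_eq_self]
      _ ≤ _ := by
          exact mul_le_mul_of_nonneg_left (integral_mono (hx x) hmax fun z => le_max_left _ _)
            (by positivity)
  · calc ∫ z, |paraboloid R (x - z) - paraboloid R (y - z)|
        ≤ ∫ z, max (paraboloid R (x - z)) (paraboloid R (y - z)) := by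
          refine integral_mono habs hmax fun z => ?_
          have h2 := paraboloid_nonneg R (x - z)
          have h3 := paraboloid_nonneg R (y - z)
          simp only
          rw [abs_le]
          constructor
          · linarith [le_max_right (paraboloid R (x - z)) (paraboloid R (y - z))]
          · linarith [le_max_left (paraboloid R (x - z)) (paraboloid R (y - z))]
      _ ≤ _ := by
          refine le_mul_of_one_le_left (integral_nonneg fun z => ?_) (by linarith)
          exact le_max_of_le_left (paraboloid_nonneg R _)

end Bump

/-! ### Lipschitz partition by carving -/

section Carving

open MeasureTheory

variable {k : ℕ} {V : Type*}

/-- Averaging over the centre of a translated paraboloid. -/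
theorem exists_center_energy_le (hk : 0 < k) {R : ℝ} (hR : 0 < R) (X : Finset V)
    (hX : X.Nonempty) (x : V → EuclideanSpace ℝ (Fin k)) (c : V → V → ℝ)
    (hc : ∀ u v, 0 ≤ c u v) :
    ∃ z, (∃ u ∈ X, 0 < paraboloid R (x u - z)) ∧
      ∑ u ∈ X, ∑ v ∈ X, c u v * |paraboloid R (x u - z) - paraboloid R (x v - z)| ≤
        ∑ u ∈ X, ∑ v ∈ X, 24 * √k / R * (c u v * dist (x u) (x v)) *
          max (paraboloid R (x u - z)) (paraboloid R (x v - z)) := by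
  by_contra! hcon
  have hcont (u : V) : Continuous fun z => paraboloid R (x u - z) :=
    (continuous_paraboloid R).comp (by fun_prop)
  have hint (u : V) : Integrable fun z => paraboloid R (x u - z) :=
    (integrable_paraboloid hR).comp_sub_left (x u)
  set H : EuclideanSpace ℝ (Fin k) → ℝ := fun z => ∑ u ∈ X, ∑ v ∈ X,
    (c u v * |paraboloid R (x u - z) - paraboloid R (x v - z)| -
      24 * √k / R * (c u v * dist (x u) (x v)) *
          max (paraboloid R (x u - z)) (paraboloid R (x v - z))) with hH
  have hHeq (z : EuclideanSpace ℝ (Fin k)) : H z =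
      ∑ u ∈ X, ∑ v ∈ X, c u v * |paraboloid R (x u - z) - paraboloid R (x v - z)| -
      ∑ u ∈ X, ∑ v ∈ X, 24 * √k / R * (c u v * dist (x u) (x v)) *
          max (paraboloid R (x u - z)) (paraboloid R (x v - z)) := by
    simp only [hH, Finset.sum_sub_distrib]
  have hHcont : Continuous H := by
    simp only [hH]
    fun_prop
  have hzero (z : EuclideanSpace ℝ (Fin k)) (hz : ∀ u ∈ X, paraboloid R (x u - z) = 0) :
      H z = 0 := by
    simp only [hH]
    refine Finset.sum_eq_zero fun u hu => Finset.sum_eq_zero fun v hv => ?_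
    simp [hz u hu, hz v hv]
  have hsupp : HasCompactSupport H := by
    refine HasCompactSupport.intro
      (K := ⋃ u ∈ X, tsupport fun z => paraboloid R (x u - z))
      (X.finite_toSet.isCompact_biUnion fun u _ => hasCompactSupport_paraboloid_sub hR (x u)) ?_
    intro z hz
    simp only [Set.mem_iUnion, not_exists] at hz
    exact hzero z fun u hu => image_eq_zero_of_notMem_tsupport
      (f := fun z => paraboloid R (x u - z)) (hz u hu)
  -- Where all bumps vanish on `X` both sides are zero, so the contrary assumption makes `H`
  -- nonnegative everywhere, and positive at the centre `x u₀`. Its integral would be positive,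
  -- against the integrated bound.
  have hnonneg : 0 ≤ H := by
    intro z
    by_cases hz : ∃ u ∈ X, 0 < paraboloid R (x u - z)
    · rw [hHeq]; exact sub_nonneg.2 (hcon z hz).le
    · push Not at hz
      exact (hzero z fun u hu => le_antisymm (hz u hu) (paraboloid_nonneg R _)).ge
  obtain ⟨u₀, hu₀⟩ := hX
  have hne : H (x u₀) ≠ 0 := by
    rw [hHeq]
    refine (sub_pos.2 (hcon (x u₀) ⟨u₀, hu₀, ?_⟩)).ne'
    rw [paraboloid_pos_iff hR]; simpa using hR
  have hpos := hHcont.integral_pos_of_hasCompactSupport_nonneg_nonzero (μ := volume)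
    hsupp hnonneg hne
  have hi (u v : V) : Integrable fun z =>
      c u v * |paraboloid R (x u - z) - paraboloid R (x v - z)| :=
    (((hint u).sub (hint v)).abs).const_mul _
  have hi' (u v : V) : Integrable fun z => 24 * √k / R * (c u v * dist (x u) (x v)) *
      max (paraboloid R (x u - z)) (paraboloid R (x v - z)) :=
    ((hint u).sup (hint v)).const_mul _
  have hi'' (u v : V) : Integrable fun z =>
      c u v * |paraboloid R (x u - z) - paraboloid R (x v - z)| -
        24 * √k / R * (c u v * dist (x u) (x v)) *
          max (paraboloid R (x u - z)) (paraboloid R (x v - z)) :=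
    (hi u v).sub (hi' u v)
  simp only [hH] at hpos
  rw [integral_finsetSum _ fun u _ => integrable_finsetSum _ fun v _ => hi'' u v] at hpos
  refine hpos.not_ge (Finset.sum_nonpos fun u _ => ?_)
  rw [integral_finsetSum _ fun v _ => hi'' u v]
  refine Finset.sum_nonpos fun v _ => ?_
  rw [integral_sub (hi u v) (hi' u v), integral_const_mul, integral_const_mul, sub_nonpos]
  refine (mul_le_mul_of_nonneg_left (integral_abs_paraboloid_sub_le hk hR (x u) (x v))
    (hc u v)).trans_eq ?_
  ring

/-- A Lipschitz partition of a finite set of points of `ℝᵏ` into pieces of diameter at most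
`2R`, the analogue of a random partition that separates `x` and `y` with probability
`O(√k ‖x - y‖ / R)`. -/
theorem exists_lipschitz_partition [DecidableEq V] (hk : 0 < k) {R : ℝ} (hR : 0 < R)
    (x : V → EuclideanSpace ℝ (Fin k)) (c : V → V → ℝ) (hc : ∀ u v, 0 ≤ c u v) (X : Finset V) :
    ∃ p : V → ℕ, (∀ u ∈ X, ∀ v ∈ X, p u = p v → dist (x u) (x v) ≤ 2 * R) ∧
      ∑ u ∈ X, ∑ v ∈ X, c u v * (if p u = p v then 0 else 1) ≤
        24 * √k / R * ∑ u ∈ X, ∑ v ∈ X, c u v * dist (x u) (x v) := by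
  induction X using Finset.strongInduction with
  | H X ih =>
  rcases X.eq_empty_or_nonempty with rfl | hX
  · exact ⟨fun _ => 0, by simp⟩
  obtain ⟨z, hz, hle⟩ := exists_center_energy_le hk hR X hX x c hc
  obtain ⟨t, ht0, ⟨u₀, hu₀, htu⟩, hcut⟩ := exists_superlevel_cut_le X
    (fun u => paraboloid R (x u - z)) (fun u => paraboloid_nonneg R _) c
    (fun u v => 24 * √k / R * (c u v * dist (x u) (x v))) hz hle
  set Q : V → Prop := fun u => t < paraboloid R (x u - z) with hQ
  have hQd (u : V) (hu : Q u) : dist (x u) z < R := by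
    rw [dist_eq_norm, ← paraboloid_pos_iff hR]
    exact ht0.trans_lt hu
  classical
  obtain ⟨p, hp, hpc⟩ := ih (X.filter fun u => ¬ Q u)
    (Finset.filter_ssubset.2 ⟨u₀, hu₀, not_not.2 htu⟩)
  -- The carved set gets the fresh label `0`. A pair is charged only in the round that first removes
  -- one of its endpoints, so the charges never exceed one copy of the total.
  refine ⟨fun u => if Q u then 0 else p u + 1, ?_, ?_⟩
  · intro u hu v hv huv
    by_cases h1 : Q u <;> by_cases h2 : Q v <;> simp only [h1, h2, if_true, if_false] at huv
    · have := dist_triangle_right (x u) (x v) z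
      linarith [hQd u h1, hQd v h2]
    · omega
    · omega
    · exact hp u (by simp [hu, h1]) v (by simp [hv, h2]) (by omega)
  · set L := 24 * √k / R with hL
    have hL0 : 0 ≤ L := by positivity
    have e1 : ∀ F : V → V → ℝ, ∑ u ∈ X with ¬ Q u, ∑ v ∈ X with ¬ Q v, F u v =
        ∑ u ∈ X, ∑ v ∈ X, if Q u ∨ Q v then 0 else F u v := by
      intro F
      rw [Finset.sum_filter]
      refine Finset.sum_congr rfl fun u _ => ?_
      by_cases h1 : Q u
      · simp [h1]
      · rw [if_pos h1, Finset.sum_filter]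
        refine Finset.sum_congr rfl fun v _ => ?_
        by_cases h2 : Q v <;> simp [h1, h2]
    rw [e1, e1, Finset.mul_sum] at hpc
    simp only [Finset.mul_sum] at hpc ⊢
    have hadd := add_le_add hcut hpc
    simp only [← Finset.sum_add_distrib] at hadd
    refine le_trans (le_of_eq ?_) (hadd.trans (le_of_eq ?_))
    · refine Finset.sum_congr rfl fun u _ => Finset.sum_congr rfl fun v _ => ?_
      change _ = c u v * (if (Q u ↔ Q v) then 0 else 1) + _
      by_cases h1 : Q u <;> by_cases h2 : Q v <;> simp [h1, h2]
    · refine Finset.sum_congr rfl fun u _ => Finset.sum_congr rfl fun v _ => ?_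
      change L * (c u v * dist (x u) (x v)) * (if Q u ∨ Q v then 1 else 0) + _ = _
      by_cases h1 : Q u ∨ Q v <;> simp [h1]

end Carving

/-! ### Greedy grouping of pieces -/

section Grouping

theorem exists_subset_sum_mem_Icc {ι : Type*} [DecidableEq ι] (m : ι → ℝ) {β : ℝ} (hβ : 1 ≤ β)
    (hm : ∀ a, m a ≤ β) (A : Finset ι) (hA : 1 / 2 ≤ ∑ a ∈ A, m a) :
    ∃ B ⊆ A, 1 / 2 ≤ ∑ a ∈ B, m a ∧ ∑ a ∈ B, m a ≤ β := by
  induction A using Finset.induction_on with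
  | empty => norm_num at hA
  | insert a A ha ih =>
    by_cases h1 : 1 / 2 ≤ ∑ a ∈ A, m a
    · obtain ⟨B, hB, h⟩ := ih h1
      exact ⟨B, hB.trans (Finset.subset_insert _ _), h⟩
    by_cases h2 : 1 / 2 ≤ m a
    · exact ⟨{a}, by simp, by simpa using h2, by simpa using hm a⟩
    · refine ⟨_, subset_rfl, hA, ?_⟩
      rw [Finset.sum_insert ha]
      linarith

/-- Each extracted group uses up at most `β`, so after `j - 1` of them `1/2` is still left for the
last. -/
theorem exists_disjoint_groups {ι : Type*} [DecidableEq ι] (m : ι → ℝ) {β : ℝ} (hβ : 1 ≤ β)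
    (hm : ∀ a, m a ≤ β) (j : ℕ) (A : Finset ι) (hA : (j - 1) * β + 1 / 2 ≤ ∑ a ∈ A, m a) :
    ∃ T : Fin j → Finset ι, (∀ i, T i ⊆ A) ∧ (Pairwise fun i i' => Disjoint (T i) (T i')) ∧
      ∀ i, 1 / 2 ≤ ∑ a ∈ T i, m a := by
  induction j generalizing A with
  | zero => exact ⟨fun i => i.elim0, fun i => i.elim0, fun i => i.elim0, fun i => i.elim0⟩
  | succ j ih =>
    have hj : (0 : ℝ) ≤ j := j.cast_nonneg
    push_cast at hA
    obtain ⟨B, hBA, hB, hB'⟩ := exists_subset_sum_mem_Icc m hβ hm A (by nlinarith)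
    have hs := Finset.sum_sdiff (f := m) hBA
    obtain ⟨T, hTA, hT, hTm⟩ := ih (A \ B) (by linarith)
    have hd (i : Fin j) : Disjoint B (T i) :=
      Finset.disjoint_of_subset_right (hTA i) Finset.disjoint_sdiff
    refine ⟨Fin.cons B T, ?_, ?_, ?_⟩
    · intro i
      refine Fin.cases hBA (fun i => ?_) i
      simpa using (hTA i).trans Finset.sdiff_subset
    · intro i i'
      refine Fin.cases ?_ (fun i => ?_) i <;> refine Fin.cases ?_ (fun i' => ?_) i'
      · simp
      · intro _; simpa using hd i'
      · intro _; simpa using (hd i).symm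
      · intro h; simpa using hT fun h' => h (by rw [h'])
    · intro i
      refine Fin.cases ?_ (fun i => ?_) i
      · simpa using hB
      · simpa using hTm i

end Grouping

/-! ### Dirichlet form and eigenbasis -/

namespace WeightedGraph

open Matrix

variable {V : Type u} [Fintype V]

theorem degree_pos' (G : WeightedGraph V) (v : V) : 0 < G.degree v := G.degree_pos v

theorem sum_weight_mul_sq_sub (G : WeightedGraph V) (a : V → ℝ) :
    (∑ u, ∑ v, G.weight u v * (a u - a v) ^ 2) / 2 =
      ∑ v, G.degree v * a v ^ 2 - ∑ u, ∑ v, G.weight u v * (a u * a v) := by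
  have h1 : ∑ u, ∑ v, G.weight u v * a u ^ 2 = ∑ v, G.degree v * a v ^ 2 := by
    simp only [degree, Finset.sum_mul]
  have h2 : ∑ u, ∑ v, G.weight u v * a v ^ 2 = ∑ v, G.degree v * a v ^ 2 := by
    rw [Finset.sum_comm, ← h1]
    simp only [G.weight_symm]
  have h3 : ∑ u, ∑ v, G.weight u v * (a u - a v) ^ 2 =
      ∑ u, ∑ v, G.weight u v * a u ^ 2 + ∑ u, ∑ v, G.weight u v * a v ^ 2
        - 2 * ∑ u, ∑ v, G.weight u v * (a u * a v) := by
    simp only [Finset.mul_sum, ← Finset.sum_add_distrib, ← Finset.sum_sub_distrib]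
    refine Finset.sum_congr rfl fun u _ => Finset.sum_congr rfl fun v _ => ?_
    ring
  rw [h3, h1, h2]; ring

theorem vol_pos (G : WeightedGraph V) {S : Finset V} (hS : S.Nonempty) : 0 < G.vol S :=
  Finset.sum_pos (fun v _ => G.degree_pos' v) hS

variable [DecidableEq V]

/-- The substitution `y = D^{1/2} a` turns the normalized Laplacian into the Dirichlet form; the
factor `1/2` compensates for ordered pairs. -/
theorem dotProduct_normLaplacian_mulVec (G : WeightedGraph V) (a : V → ℝ) :
    (fun v => √(G.degree v) * a v) ⬝ᵥ G.normLaplacian *ᵥ (fun v => √(G.degree v) * a v) =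
      (∑ u, ∑ v, G.weight u v * (a u - a v) ^ 2) / 2 := by
  have hs (v : V) : 0 < √(G.degree v) := Real.sqrt_pos.2 (G.degree_pos' v)
  have hmul : G.normLaplacian *ᵥ (fun v => √(G.degree v) * a v) = fun u =>
      √(G.degree u) * a u - (√(G.degree u))⁻¹ * ∑ v, G.weight u v * a v := by
    ext u
    rw [normLaplacian, sub_mulVec, one_mulVec, Pi.sub_apply, ← mulVec_mulVec, ← mulVec_mulVec]
    have h1 : G.invSqrtDegMatrix *ᵥ (fun v => √(G.degree v) * a v) = a := by
      ext v
      rw [invSqrtDegMatrix, mulVec_diagonal, inv_mul_cancel_left₀ (hs v).ne']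
    rw [h1, invSqrtDegMatrix, mulVec_diagonal]
    rfl
  rw [hmul, G.sum_weight_mul_sq_sub, dotProduct, ← Finset.sum_sub_distrib]
  refine Finset.sum_congr rfl fun u _ => ?_
  have h2 : √(G.degree u) * √(G.degree u) = G.degree u := Real.mul_self_sqrt (G.degree_pos' u).le
  have h3 : ∑ v, G.weight u v * (a u * a v) = a u * ∑ v, G.weight u v * a v := by
    rw [Finset.mul_sum]; exact Finset.sum_congr rfl fun v _ => by ring
  rw [h3, mul_sub, mul_mul_mul_comm, h2]
  field_simp [(hs u).ne']

/-- The orthonormal eigenbasis of the normalized Laplacian, in decreasing order of eigenvalues. -/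
noncomputable def eigenbasis (G : WeightedGraph V) (j : Fin (Fintype.card V)) :
    EuclideanSpace ℝ V :=
  G.normLaplacian_isHermitian.eigenvectorBasis (Fintype.equivOfCardEq (Fintype.card_fin _) j)

theorem normLaplacian_mulVec_eigenbasis (G : WeightedGraph V) (j : Fin (Fintype.card V)) :
    G.normLaplacian *ᵥ (G.eigenbasis j).ofLp =
      G.normLaplacian_isHermitian.eigenvalues₀ j • (G.eigenbasis j).ofLp := by
  have := G.normLaplacian_isHermitian.mulVec_eigenvectorBasis
    (Fintype.equivOfCardEq (Fintype.card_fin _) j)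
  rwa [Matrix.IsHermitian.eigenvalues, Equiv.symm_apply_apply] at this

theorem orthonormal_eigenbasis (G : WeightedGraph V) : Orthonormal ℝ G.eigenbasis :=
  G.normLaplacian_isHermitian.eigenvectorBasis.orthonormal.comp _ (Equiv.injective _)

theorem sum_inner_eigenbasis_mul (G : WeightedGraph V) (y z : EuclideanSpace ℝ V) :
    ∑ j, inner ℝ y (G.eigenbasis j) * inner ℝ (G.eigenbasis j) z = inner ℝ y z := by
  rw [← G.normLaplacian_isHermitian.eigenvectorBasis.sum_inner_mul_inner y z]
  exact Equiv.sum_comp (Fintype.equivOfCardEq (Fintype.card_fin _))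
    fun i => inner ℝ y (G.normLaplacian_isHermitian.eigenvectorBasis i) *
      inner ℝ (G.normLaplacian_isHermitian.eigenvectorBasis i) z

theorem dotProduct_normLaplacian_eq_sum (G : WeightedGraph V) (y : V → ℝ) :
    y ⬝ᵥ G.normLaplacian *ᵥ y = ∑ j, G.normLaplacian_isHermitian.eigenvalues₀ j *
      inner ℝ (G.eigenbasis j) (WithLp.toLp 2 y) ^ 2 := by
  have hT : G.normLaplacianᵀ = G.normLaplacian := by
    simpa [Matrix.IsHermitian, conjTranspose_eq_transpose_of_trivial] using
      G.normLaplacian_isHermitian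
  have h1 : y ⬝ᵥ G.normLaplacian *ᵥ y =
      inner ℝ (WithLp.toLp 2 y) (WithLp.toLp 2 (G.normLaplacian *ᵥ y)) := by
    simp [EuclideanSpace.inner_toLp_toLp, dotProduct_comm]
  rw [h1, ← G.sum_inner_eigenbasis_mul]
  refine Finset.sum_congr rfl fun j _ => ?_
  have h2 : inner ℝ (G.eigenbasis j) (WithLp.toLp 2 (G.normLaplacian *ᵥ y)) =
      G.normLaplacian_isHermitian.eigenvalues₀ j *
        inner ℝ (G.eigenbasis j) (WithLp.toLp 2 y) := by
    have e (z : V → ℝ) : inner ℝ (G.eigenbasis j) (WithLp.toLp 2 z) =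
        (G.eigenbasis j).ofLp ⬝ᵥ z := by
      rw [EuclideanSpace.inner_eq_star_dotProduct, dotProduct_comm]; simp
    rw [e, e, dotProduct_mulVec, ← mulVec_transpose, hT, normLaplacian_mulVec_eigenbasis,
      smul_dotProduct, smul_eq_mul]
  rw [h2, real_inner_comm]
  ring

/-! ### Courant–Fischer and the lower bound -/

/-- Courant–Fischer: every parametrized `k`-dimensional test space contains a vector whose
Rayleigh quotient is at least `λ_k`. -/
theorem exists_lam_mul_le (G : WeightedGraph V) (k : ℕ) (hk₁ : 1 ≤ k) (hk₂ : k ≤ Fintype.card V)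
    (Φ : (Fin k → ℝ) →ₗ[ℝ] (V → ℝ)) :
    ∃ α ≠ 0, G.lam k hk₁ hk₂ * ∑ v, G.degree v * Φ α v ^ 2 ≤
      (∑ u, ∑ v, G.weight u v * (Φ α u - Φ α v) ^ 2) / 2 := by
  let Y : (V → ℝ) →ₗ[ℝ] EuclideanSpace ℝ V :=
    (WithLp.linearEquiv 2 ℝ (V → ℝ)).symm.toLinearMap ∘ₗ
      LinearMap.pi fun v => √(G.degree v) • LinearMap.proj v
  have hY (a : V → ℝ) : Y a = WithLp.toLp 2 fun v => √(G.degree v) * a v := rfl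
  -- Orthogonality to the last `k - 1` eigenvectors, those of the smallest eigenvalues, imposes `k -
  -- 1` conditions on `k` parameters. All remaining eigenvalues are at least `λ_k`.
  let Ψ : (Fin k → ℝ) →ₗ[ℝ] (Fin (k - 1) → ℝ) := LinearMap.pi fun i =>
    (innerₗ _ (G.eigenbasis ⟨Fintype.card V - k + 1 + i, by omega⟩)) ∘ₗ Y ∘ₗ Φ
  have hker : LinearMap.ker Ψ ≠ ⊥ := LinearMap.ker_ne_bot_of_finrank_lt (by simp; omega)
  obtain ⟨α, hα, hα0⟩ := (Submodule.ne_bot_iff _).1 hker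
  refine ⟨α, hα0, ?_⟩
  rw [← dotProduct_normLaplacian_mulVec, dotProduct_normLaplacian_eq_sum]
  set y := WithLp.toLp 2 fun v => √(G.degree v) * Φ α v with hy
  have hnorm : ∑ v, G.degree v * Φ α v ^ 2 = ∑ j, inner ℝ (G.eigenbasis j) y ^ 2 := by
    have h1 : inner ℝ y y = ∑ v, G.degree v * Φ α v ^ 2 := by
      rw [real_inner_self_eq_norm_sq, EuclideanSpace.norm_sq_eq]
      refine Finset.sum_congr rfl fun v _ => ?_
      rw [Real.norm_eq_abs, sq_abs, hy]
      simp only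
      rw [mul_pow, Real.sq_sqrt (G.degree_pos' v).le]
    rw [← h1, ← G.sum_inner_eigenbasis_mul]
    refine Finset.sum_congr rfl fun j _ => ?_
    rw [real_inner_comm, sq]
  rw [hnorm, Finset.mul_sum]
  refine Finset.sum_le_sum fun j _ => ?_
  by_cases hj : (j : ℕ) ≤ Fintype.card V - k
  · refine mul_le_mul_of_nonneg_right ?_ (sq_nonneg _)
    exact G.normLaplacian_isHermitian.eigenvalues₀_antitone hj
  · have h0 := congrFun (LinearMap.mem_ker.1 hα) ⟨j - (Fintype.card V - k + 1), by omega⟩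
    have h1 : inner ℝ (G.eigenbasis j) y = 0 := by
      have h2 : (⟨Fintype.card V - k + 1 + (j - (Fintype.card V - k + 1)), by omega⟩ :
        Fin (Fintype.card V)) = j := Fin.ext (by simp; omega)
      simp only [Ψ, LinearMap.pi_apply, LinearMap.comp_apply, innerₗ_apply_apply, hY, h2] at h0
      exact h0
    rw [h1]; simp

theorem sum_weight_mul_indicator (G : WeightedGraph V) (S : Finset V) :
    ∑ u, ∑ v, G.weight u v * (if (u ∈ S ↔ v ∈ S) then 0 else 1) = 2 * G.cutWeight S := by
  have h1 : ∑ u, ∑ v, G.weight u v * (if (u ∈ S ∧ v ∉ S) then 1 else 0) = G.cutWeight S := by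
    rw [cutWeight, ← Finset.sum_filter_add_sum_filter_not Finset.univ (· ∈ S)]
    rw [Finset.sum_eq_zero (s := Finset.univ.filter (· ∉ S)) ?_, add_zero]
    · rw [Finset.filter_mem_eq_inter, Finset.univ_inter]
      refine Finset.sum_congr rfl fun u hu => ?_
      simp only [hu, true_and, mul_ite, mul_one, mul_zero]
      rw [← Finset.sum_filter]
      refine Finset.sum_congr ?_ fun _ _ => rfl
      ext; simp
    · intro u hu
      refine Finset.sum_eq_zero fun v _ => ?_
      rw [Finset.mem_filter] at hu
      simp [hu.2]
  have h2 : ∑ u, ∑ v, G.weight u v * (if (v ∈ S ∧ u ∉ S) then 1 else 0) = G.cutWeight S := by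
    rw [Finset.sum_comm, ← h1]
    simp only [G.weight_symm]
  rw [two_mul]
  nth_rw 1 [← h1]
  rw [← h2]
  simp only [← Finset.sum_add_distrib]
  refine Finset.sum_congr rfl fun u _ => Finset.sum_congr rfl fun v _ => ?_
  by_cases hu : u ∈ S <;> by_cases hv : v ∈ S <;> simp [hu, hv]

theorem lam_le_of_disjoint (G : WeightedGraph V) (k : ℕ) (hk₁ : 1 ≤ k)
    (hk₂ : k ≤ Fintype.card V) (S : Fin k → Finset V) (hne : ∀ i, (S i).Nonempty)
    (hS : Pairwise fun i j => Disjoint (S i) (S j)) {m : ℝ} (hm : ∀ i, G.expansion (S i) ≤ m) :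
    G.lam k hk₁ hk₂ / 2 ≤ m := by
  let Φ : (Fin k → ℝ) →ₗ[ℝ] (V → ℝ) := LinearMap.pi fun v =>
    ∑ i, (if v ∈ S i then (1 : ℝ) else 0) • LinearMap.proj i
  have hΦ (α : Fin k → ℝ) (v : V) : Φ α v = ∑ i, if v ∈ S i then α i else 0 := by
    simp only [Φ, LinearMap.pi_apply, LinearMap.sum_apply]
    exact Finset.sum_congr rfl fun i _ => by split_ifs <;> simp
  have hin (α : Fin k → ℝ) {v : V} {i : Fin k} (hv : v ∈ S i) (f : Fin k → ℝ) :
      ∑ j, (if v ∈ S j then f j else 0) = f i := by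
    rw [Finset.sum_eq_single i, if_pos hv]
    · intro j _ hj
      rw [if_neg fun h => Finset.disjoint_left.1 (hS hj) h hv]
    · simp
  have hsq (α : Fin k → ℝ) (v : V) : Φ α v ^ 2 = ∑ i, if v ∈ S i then α i ^ 2 else 0 := by
    rw [hΦ]
    by_cases h : ∃ i, v ∈ S i
    · obtain ⟨i, hi⟩ := h
      rw [hin α hi, hin α hi]
    · push Not at h
      simp [h]
  obtain ⟨α, hα0, hα⟩ := G.exists_lam_mul_le k hk₁ hk₂ Φ
  have hvol : ∑ v, G.degree v * Φ α v ^ 2 = ∑ i, α i ^ 2 * G.vol (S i) := by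
    simp only [hsq, Finset.mul_sum, vol]
    rw [Finset.sum_comm]
    refine Finset.sum_congr rfl fun i _ => ?_
    simp only [mul_ite, mul_zero]
    rw [← Finset.sum_filter, Finset.filter_mem_eq_inter, Finset.univ_inter]
    exact Finset.sum_congr rfl fun v _ => mul_comm _ _
  -- Unless `u` and `v` share a set, the sum equals `Φ α u ^ 2 + Φ α v ^ 2`; the factor `2` here is
  -- the one in `λ_k / 2`.
  have hpt (u v : V) : (Φ α u - Φ α v) ^ 2 ≤
      2 * ∑ i, α i ^ 2 * (if (u ∈ S i ↔ v ∈ S i) then 0 else 1) := by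
    by_cases h : ∃ i, u ∈ S i ∧ v ∈ S i
    · obtain ⟨i, hu, hv⟩ := h
      rw [hΦ, hΦ, hin α hu, hin α hv, sub_self]
      have : 0 ≤ ∑ i, α i ^ 2 * (if (u ∈ S i ↔ v ∈ S i) then (0 : ℝ) else 1) :=
        Finset.sum_nonneg fun i _ => by split_ifs <;> simp [sq_nonneg]
      simpa using this
    · push Not at h
      have h1 : ∑ i, α i ^ 2 * (if (u ∈ S i ↔ v ∈ S i) then (0 : ℝ) else 1) =
          Φ α u ^ 2 + Φ α v ^ 2 := by
        rw [hsq, hsq, ← Finset.sum_add_distrib]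
        refine Finset.sum_congr rfl fun i _ => ?_
        by_cases hu : u ∈ S i
        · simp [hu, h i hu]
        · by_cases hv : v ∈ S i <;> simp [hu, hv]
      rw [h1]
      nlinarith [sq_nonneg (Φ α u + Φ α v)]
  have hE : (∑ u, ∑ v, G.weight u v * (Φ α u - Φ α v) ^ 2) / 2 ≤
      2 * m * ∑ i, α i ^ 2 * G.vol (S i) := by
    calc (∑ u, ∑ v, G.weight u v * (Φ α u - Φ α v) ^ 2) / 2
        ≤ (∑ u, ∑ v, G.weight u v *
            (2 * ∑ i, α i ^ 2 * (if (u ∈ S i ↔ v ∈ S i) then 0 else 1))) / 2 := by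
          gcongr with u _ v _
          · exact G.weight_nonneg u v
          · exact hpt u v
      _ = ∑ i, α i ^ 2 *
            ∑ u, ∑ v, G.weight u v * (if (u ∈ S i ↔ v ∈ S i) then 0 else 1) := by
          have : ∑ u, ∑ v, G.weight u v *
              (2 * ∑ i, α i ^ 2 * (if (u ∈ S i ↔ v ∈ S i) then (0 : ℝ) else 1)) =
              2 * ∑ u, ∑ v, ∑ i, α i ^ 2 *
                (G.weight u v * (if (u ∈ S i ↔ v ∈ S i) then 0 else 1)) := by
            simp only [Finset.mul_sum]
            refine Finset.sum_congr rfl fun u _ => Finset.sum_congr rfl fun v _ =>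
              Finset.sum_congr rfl fun i _ => ?_
            ring
          rw [this, mul_div_cancel_left₀ _ two_ne_zero]
          simp only [Finset.mul_sum]
          symm
          rw [Finset.sum_comm]
          exact Finset.sum_congr rfl fun u _ => Finset.sum_comm
      _ ≤ ∑ i, α i ^ 2 * (2 * (m * G.vol (S i))) := by
          gcongr with i _
          rw [sum_weight_mul_indicator]
          have := hm i
          rw [expansion, div_le_iff₀ (G.vol_pos (hne i))] at this
          linarith
      _ = _ := by
          rw [Finset.mul_sum]
          exact Finset.sum_congr rfl fun i _ => by ring
  have hpos : 0 < ∑ i, α i ^ 2 * G.vol (S i) := by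
    obtain ⟨i, hi⟩ := Function.ne_iff.1 hα0
    refine Finset.sum_pos' (fun i _ => mul_nonneg (sq_nonneg _) (G.vol_pos (hne i)).le)
      ⟨i, Finset.mem_univ _, mul_pos (sq_pos_of_ne_zero hi) (G.vol_pos (hne i))⟩
  rw [hvol] at hα
  have := le_of_mul_le_mul_right (hα.trans hE) hpos
  linarith

instance finite_disjointFamily (k : ℕ) : Finite (DisjointFamily V k) :=
  inferInstanceAs (Finite {S : Fin k → Finset V //
    (∀ i, (S i).Nonempty) ∧ Pairwise fun i j => Disjoint (S i) (S j)})

omit [DecidableEq V] in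
theorem nonempty_disjointFamily {k : ℕ} (hk : k ≤ Fintype.card V) :
    Nonempty (DisjointFamily V k) := by
  obtain ⟨f⟩ : Nonempty (Fin k ↪ V) := Function.Embedding.nonempty_of_card_le (by simpa using hk)
  exact ⟨⟨fun i => {f i}, by simp, fun i j h => by simpa using h⟩⟩

theorem lam_le_kWayExpansion (G : WeightedGraph V) (k : ℕ) (hk₁ : 1 ≤ k)
    (hk₂ : k ≤ Fintype.card V) : G.lam k hk₁ hk₂ / 2 ≤ G.kWayExpansion k := by
  have := nonempty_disjointFamily hk₂
  refine le_ciInf fun S => ?_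
  exact G.lam_le_of_disjoint k hk₁ hk₂ S.1 S.2.1 S.2.2 fun i =>
    le_ciSup (f := fun i => G.expansion (S.1 i)) (Set.finite_range _).bddAbove i

/-! ### The spectral embedding: isotropy and energy -/

/-- The spectral embedding by the eigenvectors of the `k` smallest eigenvalues. -/
noncomputable def spectralEmbedding (G : WeightedGraph V) (k : ℕ) (hk : k ≤ Fintype.card V)
    (u : V) : EuclideanSpace ℝ (Fin k) :=
  WithLp.toLp 2 fun i => G.eigenbasis ⟨Fintype.card V - k + i, by omega⟩ u / √(G.degree u)

/-- Isotropy is the orthonormality of the eigenvectors read row by row: undoing the division by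
`√d(u)` gives coordinate `u` of `∑ e i • eigenvector i`, a vector of norm `‖e‖`. -/
theorem sum_degree_mul_inner_spectralEmbedding_sq (G : WeightedGraph V) (k : ℕ)
    (hk : k ≤ Fintype.card V) (e : EuclideanSpace ℝ (Fin k)) :
    ∑ u, G.degree u * inner ℝ (G.spectralEmbedding k hk u) e ^ 2 = ‖e‖ ^ 2 := by
  have horth : Orthonormal ℝ fun i : Fin k =>
      G.eigenbasis ⟨Fintype.card V - k + i, by omega⟩ :=
    G.orthonormal_eigenbasis.comp _ fun i j h => by simpa [Fin.ext_iff] using h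
  have h1 := horth.inner_sum e e Finset.univ
  have h2 : inner ℝ e e = ∑ i, e i * e i := by
    rw [real_inner_self_eq_norm_sq, EuclideanSpace.norm_sq_eq]
    simp [sq]
  rw [← real_inner_self_eq_norm_sq, h2]
  simp only [conj_trivial] at h1
  rw [← h1, real_inner_self_eq_norm_sq, EuclideanSpace.norm_sq_eq]
  refine Finset.sum_congr rfl fun u _ => ?_
  have hs : 0 < √(G.degree u) := Real.sqrt_pos.2 (G.degree_pos' u)
  have h3 : √(G.degree u) * inner ℝ (G.spectralEmbedding k hk u) e =
      (∑ i : Fin k, e i • G.eigenbasis ⟨Fintype.card V - k + i, by omega⟩) u := by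
    simp only [spectralEmbedding, PiLp.inner_apply, Finset.mul_sum, WithLp.ofLp_sum,
      Finset.sum_apply, PiLp.smul_apply, RCLike.inner_apply, conj_trivial, smul_eq_mul]
    refine Finset.sum_congr rfl fun i _ => ?_
    field_simp
  rw [← h3, Real.norm_eq_abs, sq_abs, mul_pow, Real.sq_sqrt (G.degree_pos' u).le]

theorem sum_weight_mul_norm_sub_sq_le (G : WeightedGraph V) (k : ℕ) (hk₁ : 1 ≤ k)
    (hk : k ≤ Fintype.card V) :
    ∑ u, ∑ v, G.weight u v *
      ‖G.spectralEmbedding k hk u - G.spectralEmbedding k hk v‖ ^ 2 ≤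
      2 * k * G.lam k hk₁ hk := by
  have h1 (i : Fin k) : ∑ u, ∑ v, G.weight u v *
      (G.spectralEmbedding k hk u i - G.spectralEmbedding k hk v i) ^ 2 ≤
        2 * G.lam k hk₁ hk := by
    set j : Fin (Fintype.card V) := ⟨Fintype.card V - k + i, by omega⟩ with hj
    have h2 := G.dotProduct_normLaplacian_mulVec fun u => G.spectralEmbedding k hk u i
    have h3 : (fun v => √(G.degree v) * G.spectralEmbedding k hk v i) =
        (G.eigenbasis j).ofLp := by
      ext v
      have hs : 0 < √(G.degree v) := Real.sqrt_pos.2 (G.degree_pos' v)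
      simp only [spectralEmbedding]
      field_simp
      rfl
    have h4 : (G.eigenbasis j).ofLp ⬝ᵥ (G.eigenbasis j).ofLp = 1 := by
      have := G.orthonormal_eigenbasis.1 j
      have h5 : inner ℝ (G.eigenbasis j) (G.eigenbasis j) = 1 := by
        rw [real_inner_self_eq_norm_sq, this]; norm_num
      rw [EuclideanSpace.inner_eq_star_dotProduct] at h5
      simpa using h5
    rw [h3, normLaplacian_mulVec_eigenbasis, dotProduct_smul, h4, smul_eq_mul, mul_one] at h2
    have h6 : G.normLaplacian_isHermitian.eigenvalues₀ j ≤ G.lam k hk₁ hk :=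
      G.normLaplacian_isHermitian.eigenvalues₀_antitone (by simp [hj, Fin.le_def])
    linarith
  calc _ = ∑ i, ∑ u, ∑ v, G.weight u v *
      (G.spectralEmbedding k hk u i - G.spectralEmbedding k hk v i) ^ 2 := by
        symm
        rw [Finset.sum_comm]
        refine Finset.sum_congr rfl fun u _ => ?_
        rw [Finset.sum_comm]
        refine Finset.sum_congr rfl fun v _ => ?_
        rw [← Finset.mul_sum, EuclideanSpace.norm_sq_eq]
        simp
    _ ≤ ∑ i : Fin k, 2 * G.lam k hk₁ hk := Finset.sum_le_sum fun i _ => h1 i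
    _ = _ := by simp; ring

end WeightedGraph

/-! ### From the embedding to `k` disjoint sets -/

/-- The left side is `‖‖b‖ • a - ‖a‖ • b‖`, bounded by both `2‖b‖‖a - b‖` and `2‖a‖‖a - b‖`; their
average is the claim. It converts the cost of partitioning directions into `ℓ¹` energy. -/
theorem norm_mul_norm_mul_dist_normalize_le {E : Type*} [NormedAddCommGroup E] [NormedSpace ℝ E]
    {a b : E} (ha : a ≠ 0) (hb : b ≠ 0) :
    ‖a‖ * ‖b‖ * dist (‖a‖⁻¹ • a) (‖b‖⁻¹ • b) ≤ (‖a‖ + ‖b‖) * ‖a - b‖ := by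
  have ha' : 0 < ‖a‖ := norm_pos_iff.2 ha
  have hb' : 0 < ‖b‖ := norm_pos_iff.2 hb
  have h0 : ‖a‖ * ‖b‖ * dist (‖a‖⁻¹ • a) (‖b‖⁻¹ • b) = ‖‖b‖ • a - ‖a‖ • b‖ := by
    rw [dist_eq_norm, ← abs_of_pos (mul_pos ha' hb'), ← Real.norm_eq_abs, ← norm_smul, smul_sub,
      smul_smul, smul_smul]
    congr 3 <;> field_simp
  have hab : |‖b‖ - ‖a‖| ≤ ‖a - b‖ := by rw [abs_sub_comm]; exact abs_norm_sub_norm_le a b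
  have h1 : ‖‖b‖ • a - ‖a‖ • b‖ ≤ 2 * ‖b‖ * ‖a - b‖ := by
    have e : ‖b‖ • a - ‖a‖ • b = ‖b‖ • (a - b) + (‖b‖ - ‖a‖) • b := by
      rw [smul_sub, sub_smul]; abel
    rw [e]
    refine (norm_add_le _ _).trans ?_
    rw [norm_smul, norm_smul, norm_norm, Real.norm_eq_abs]
    nlinarith
  have h2 : ‖‖b‖ • a - ‖a‖ • b‖ ≤ 2 * ‖a‖ * ‖a - b‖ := by
    have e : ‖b‖ • a - ‖a‖ • b = ‖a‖ • (a - b) + (‖b‖ - ‖a‖) • a := by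
      rw [smul_sub, sub_smul]; abel
    rw [e]
    refine (norm_add_le _ _).trans ?_
    rw [norm_smul, norm_smul, norm_norm, Real.norm_eq_abs]
    nlinarith
  rw [h0]
  linarith

theorem abs_norm_sq_sub_norm_sq_le {E : Type*} [NormedAddCommGroup E] (a b : E) :
    |‖a‖ ^ 2 - ‖b‖ ^ 2| ≤ (‖a‖ + ‖b‖) * ‖a - b‖ := by
  rw [sq_sub_sq, abs_mul, abs_of_nonneg (by positivity : 0 ≤ ‖a‖ + ‖b‖)]
  gcongr
  exact abs_norm_sub_norm_le a b

namespace WeightedGraph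

variable {V : Type u} [Fintype V] [DecidableEq V]

/-- Cheeger's sweep argument in `ℓ¹` form. -/
theorem exists_expansion_le (G : WeightedGraph V) (g : V → ℝ) (hg : ∀ u, 0 ≤ g u)
    (hpos : ∃ u, 0 < g u) {A : ℝ}
    (h : ∑ u, ∑ v, G.weight u v * |g u - g v| ≤ 2 * A * ∑ u, G.degree u * g u) :
    ∃ S : Finset V, S.Nonempty ∧ (∀ u ∈ S, 0 < g u) ∧ G.expansion S ≤ A := by
  -- A diagonal budget `e` turns the sum of maxima into the degree mass of `g`, and the bound at
  -- level `t` into a volume.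
  obtain ⟨t, ht, ⟨u, -, hu⟩, hcut⟩ := exists_superlevel_cut_le Finset.univ g hg G.weight
    (fun u v => if u = v then 2 * A * G.degree u else 0) (by simpa using hpos) (by
      refine h.trans_eq ?_
      rw [Finset.mul_sum]
      exact Finset.sum_congr rfl fun u _ => by simp [mul_assoc])
  have hne : (Finset.univ.filter fun u => t < g u).Nonempty := ⟨u, by simpa using hu⟩
  refine ⟨Finset.univ.filter fun u => t < g u, hne, ?_, ?_⟩
  · intro u hu
    exact ht.trans_lt (Finset.mem_filter.1 hu).2
  · rw [expansion, div_le_iff₀ (G.vol_pos hne)]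
    have h1 := G.sum_weight_mul_indicator (Finset.univ.filter fun u => t < g u)
    simp only [Finset.mem_filter, Finset.mem_univ, true_and] at h1
    rw [h1] at hcut
    have h2 : ∑ u, ∑ v, (if u = v then 2 * A * G.degree u else 0) *
        (if t < g u ∨ t < g v then 1 else 0) =
          2 * (A * G.vol (Finset.univ.filter fun u => t < g u)) := by
      rw [vol, Finset.sum_filter, Finset.mul_sum, Finset.mul_sum]
      refine Finset.sum_congr rfl fun u _ => ?_
      rw [Finset.sum_eq_single u (fun v _ hv => by rw [if_neg hv.symm, zero_mul]) (by simp)]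
      simp [mul_assoc]
    rw [h2] at hcut
    linarith

section Embedding

variable (G : WeightedGraph V) {k : ℕ} (F : V → EuclideanSpace ℝ (Fin k))

omit [DecidableEq V] in
theorem sum_degree_mul_norm_sq
    (hF : ∀ e, ∑ u, G.degree u * inner ℝ (F u) e ^ 2 = ‖e‖ ^ 2) :
    ∑ u, G.degree u * ‖F u‖ ^ 2 = k := by
  have h1 : ∀ u, ‖F u‖ ^ 2 = ∑ i, inner ℝ (F u) (EuclideanSpace.single i (1 : ℝ)) ^ 2 := by
    intro u
    rw [EuclideanSpace.norm_sq_eq]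
    simp [EuclideanSpace.inner_single_right]
  simp only [h1, Finset.mul_sum]
  rw [Finset.sum_comm]
  simp [hF]

omit [DecidableEq V] in
theorem sum_weight_mul_norm_add_mul_norm_sub_le
    (hF : ∀ e, ∑ u, G.degree u * inner ℝ (F u) e ^ 2 = ‖e‖ ^ 2) {l : ℝ} (hl : 0 ≤ l)
    (hE : ∑ u, ∑ v, G.weight u v * ‖F u - F v‖ ^ 2 ≤ 2 * k * l) :
    ∑ u, ∑ v, G.weight u v * ((‖F u‖ + ‖F v‖) * ‖F u - F v‖) ≤ 3 * k * √l := by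
  have hM := G.sum_degree_mul_norm_sq F hF
  have h1 : ∑ u, ∑ v, G.weight u v * (‖F u‖ + ‖F v‖) ^ 2 ≤ 4 * k := by
    have e1 : ∑ u, ∑ v, G.weight u v * ‖F u‖ ^ 2 = k := by
      rw [← hM]; simp only [degree, Finset.sum_mul]
    have e2 : ∑ u, ∑ v, G.weight u v * ‖F v‖ ^ 2 = k := by
      rw [Finset.sum_comm, ← e1]; simp only [G.weight_symm]
    calc ∑ u, ∑ v, G.weight u v * (‖F u‖ + ‖F v‖) ^ 2
        ≤ ∑ u, ∑ v, (2 * (G.weight u v * ‖F u‖ ^ 2) + 2 * (G.weight u v * ‖F v‖ ^ 2)) := by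
          refine Finset.sum_le_sum fun u _ => Finset.sum_le_sum fun v _ => ?_
          nlinarith [mul_nonneg (G.weight_nonneg u v) (sq_nonneg (‖F u‖ - ‖F v‖))]
      _ = 4 * k := by
          simp only [Finset.sum_add_distrib, ← Finset.mul_sum]
          rw [e1, e2]; ring
  have hcs := Finset.sum_sq_le_sum_mul_sum_of_sq_le_mul (Finset.univ : Finset (V × V))
    (r := fun p => G.weight p.1 p.2 * ((‖F p.1‖ + ‖F p.2‖) * ‖F p.1 - F p.2‖))
    (f := fun p => G.weight p.1 p.2 * (‖F p.1‖ + ‖F p.2‖) ^ 2)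
    (g := fun p => G.weight p.1 p.2 * ‖F p.1 - F p.2‖ ^ 2)
    (fun p _ => mul_nonneg (G.weight_nonneg _ _) (sq_nonneg _))
    (fun p _ => mul_nonneg (G.weight_nonneg _ _) (sq_nonneg _)) (fun p _ => le_of_eq (by ring))
  rw [Fintype.sum_prod_type, Fintype.sum_prod_type, Fintype.sum_prod_type] at hcs
  simp only at hcs
  have hnn : 0 ≤ ∑ u, ∑ v, G.weight u v * ‖F u - F v‖ ^ 2 :=
    Finset.sum_nonneg fun u _ => Finset.sum_nonneg fun v _ =>
      mul_nonneg (G.weight_nonneg _ _) (sq_nonneg _)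
  -- Cauchy–Schwarz gives `4k · 2kl = 8k²l`, rounded up to `(3k√l)²`.
  have h2 := hcs.trans (mul_le_mul h1 hE hnn (by positivity))
  refine le_of_sq_le_sq ?_ (by positivity)
  rw [mul_pow, Real.sq_sqrt hl]
  have : 0 ≤ (k : ℝ) ^ 2 * l := by positivity
  nlinarith

omit [DecidableEq V] in
/-- The spreading property: a piece of radial diameter `O(1/√k)` carries little more than the
fraction `1/k` of the total mass. -/
theorem sum_degree_mul_norm_sq_le_of_dist_le (hk : 0 < k)
    (hF : ∀ e, ∑ u, G.degree u * inner ℝ (F u) e ^ 2 = ‖e‖ ^ 2) (S : Finset V)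
    (hS0 : ∀ u ∈ S, F u ≠ 0)
    (hS : ∀ u ∈ S, ∀ v ∈ S,
      dist (‖F u‖⁻¹ • F u) (‖F v‖⁻¹ • F v) ≤ 2 * (1 / (4 * √k))) :
    ∑ u ∈ S, G.degree u * ‖F u‖ ^ 2 ≤ 1 + 1 / (2 * k) := by
  have hk' : (1 : ℝ) ≤ k := by exact_mod_cast hk
  rcases S.eq_empty_or_nonempty with rfl | ⟨v, hv⟩
  · rw [Finset.sum_empty]; positivity
  set y : ℝ := 1 / (4 * k) with hy
  have hy0 : 0 < y := by positivity
  have hy1 : y ≤ 1 / 4 := by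
    rw [hy]; apply one_div_le_one_div_of_le <;> linarith
  have hy2 : 1 + 1 / (2 * (k : ℝ)) = 1 + 2 * y := by rw [hy]; field_simp; ring
  -- Test isotropy in the direction of one point of the piece: all others are within squared
  -- distance `y = 1/(4k)` of it, so at least `1 - y` of their mass is seen by `e`, which sees `1`
  -- in total.
  set e := ‖F v‖⁻¹ • F v with he
  have hunit (u : V) (hu : u ∈ S) : ‖‖F u‖⁻¹ • F u‖ = 1 := by
    rw [norm_smul, norm_inv, norm_norm, inv_mul_cancel₀ (norm_ne_zero_iff.2 (hS0 u hu))]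
  have hpt (u : V) (hu : u ∈ S) : (1 - y) * ‖F u‖ ^ 2 ≤ inner ℝ (F u) e ^ 2 := by
    have h1 : inner ℝ (F u) e = ‖F u‖ * inner ℝ (‖F u‖⁻¹ • F u) e := by
      rw [real_inner_smul_left, mul_inv_cancel_left₀ (norm_ne_zero_iff.2 (hS0 u hu))]
    have h2 : dist (‖F u‖⁻¹ • F u) e ^ 2 ≤ y := by
      have := pow_le_pow_left₀ dist_nonneg (hS u hu v hv) 2
      refine this.trans_eq ?_
      rw [mul_pow, div_pow, mul_pow, Real.sq_sqrt (by positivity), hy]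
      field_simp; norm_num
    rw [dist_eq_norm, norm_sub_sq_real, hunit u hu, hunit v hv] at h2
    have h3 : 1 - y / 2 ≤ inner ℝ (‖F u‖⁻¹ • F u) e := by linarith
    have h4 : 1 - y ≤ inner ℝ (‖F u‖⁻¹ • F u) e ^ 2 := by nlinarith
    rw [h1, mul_pow, mul_comm]
    gcongr
  have hsum : (1 - y) * ∑ u ∈ S, G.degree u * ‖F u‖ ^ 2 ≤ 1 := by
    calc (1 - y) * ∑ u ∈ S, G.degree u * ‖F u‖ ^ 2
        = ∑ u ∈ S, G.degree u * ((1 - y) * ‖F u‖ ^ 2) := by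
          rw [Finset.mul_sum]; exact Finset.sum_congr rfl fun u _ => by ring
      _ ≤ ∑ u ∈ S, G.degree u * inner ℝ (F u) e ^ 2 :=
          Finset.sum_le_sum fun u hu =>
            mul_le_mul_of_nonneg_left (hpt u hu) (G.degree_pos' u).le
      _ ≤ ∑ u, G.degree u * inner ℝ (F u) e ^ 2 :=
          Finset.sum_le_sum_of_subset_of_nonneg (Finset.subset_univ S) fun u _ _ =>
            mul_nonneg (G.degree_pos' u).le (sq_nonneg _)
      _ = 1 := by rw [hF, hunit v hv]; norm_num
  rw [hy2]
  have h5 : 1 ≤ (1 - y) * (1 + 2 * y) := by nlinarith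
  exact le_of_mul_le_mul_left (hsum.trans h5) (by linarith)

theorem exists_disjoint_expansion_le (hk : 0 < k)
    (hF : ∀ e, ∑ u, G.degree u * inner ℝ (F u) e ^ 2 = ‖e‖ ^ 2) {l : ℝ} (hl : 0 ≤ l)
    (hE : ∑ u, ∑ v, G.weight u v * ‖F u - F v‖ ^ 2 ≤ 2 * k * l) :
    ∃ S : Fin k → Finset V, (∀ i, (S i).Nonempty) ∧
      (Pairwise fun i j => Disjoint (S i) (S j)) ∧
      ∀ i, G.expansion (S i) ≤ 291 * (k : ℝ) ^ 2 * √l := by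
  have hk' : (1 : ℝ) ≤ k := by exact_mod_cast hk
  have hM := G.sum_degree_mul_norm_sq F hF
  have hW := G.sum_weight_mul_norm_add_mul_norm_sub_le F hF hl hE
  set W := ∑ u, ∑ v, G.weight u v * ((‖F u‖ + ‖F v‖) * ‖F u - F v‖) with hWdef
  -- Vertices with `F u = 0` have no direction, and carry no mass.
  set X := Finset.univ.filter fun u => F u ≠ 0 with hX
  obtain ⟨p, hp, hpc⟩ := exists_lipschitz_partition hk
    (R := 1 / (4 * √k)) (by positivity) (fun u => ‖F u‖⁻¹ • F u)
    (fun u v => G.weight u v * (‖F u‖ * ‖F v‖))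
    (fun u v => mul_nonneg (G.weight_nonneg u v) (by positivity)) X
  have hcut : ∑ u ∈ X, ∑ v ∈ X, G.weight u v * (‖F u‖ * ‖F v‖) * (if p u = p v then 0 else 1) ≤
      96 * k * W := by
    have h1 : 24 * √k / (1 / (4 * √(k : ℝ))) = 96 * k := by
      rw [div_div_eq_mul_div, div_one]
      have := Real.mul_self_sqrt (Nat.cast_nonneg (α := ℝ) k)
      linear_combination 96 * this
    rw [h1] at hpc
    refine hpc.trans (mul_le_mul_of_nonneg_left ?_ (by positivity))
    have hnn (u v : V) : 0 ≤ G.weight u v * ((‖F u‖ + ‖F v‖) * ‖F u - F v‖) :=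
      mul_nonneg (G.weight_nonneg u v) (by positivity)
    calc _ ≤ ∑ u ∈ X, ∑ v ∈ X, G.weight u v * ((‖F u‖ + ‖F v‖) * ‖F u - F v‖) := by
          refine Finset.sum_le_sum fun u hu => Finset.sum_le_sum fun v hv => ?_
          rw [mul_assoc]
          exact mul_le_mul_of_nonneg_left (norm_mul_norm_mul_dist_normalize_le
            (Finset.mem_filter.1 hu).2 (Finset.mem_filter.1 hv).2) (G.weight_nonneg u v)
      _ ≤ ∑ u ∈ X, ∑ v, G.weight u v * ((‖F u‖ + ‖F v‖) * ‖F u - F v‖) :=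
          Finset.sum_le_sum fun u _ => Finset.sum_le_sum_of_subset_of_nonneg
            (Finset.subset_univ X) fun v _ _ => hnn u v
      _ ≤ W := Finset.sum_le_sum_of_subset_of_nonneg (Finset.subset_univ X) fun u _ _ =>
            Finset.sum_nonneg fun v _ => hnn u v
  have hfib (B : Finset ℕ) : ∑ a ∈ B, ∑ u ∈ X with p u = a, G.degree u * ‖F u‖ ^ 2 =
      ∑ u ∈ X with p u ∈ B, G.degree u * ‖F u‖ ^ 2 := by
    rw [← Finset.sum_fiberwise_of_maps_to (g := p) (t := B)
      (fun u hu => (Finset.mem_filter.1 hu).2)]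
    refine Finset.sum_congr rfl fun a ha => Finset.sum_congr ?_ fun _ _ => rfl
    ext u
    simp only [Finset.mem_filter]
    constructor
    · rintro ⟨h1, rfl⟩; exact ⟨⟨h1, ha⟩, rfl⟩
    · rintro ⟨⟨h1, _⟩, h2⟩; exact ⟨h1, h2⟩
  have hXM : ∑ u ∈ X, G.degree u * ‖F u‖ ^ 2 = k := by
    rw [← hM, hX, Finset.sum_filter]
    refine Finset.sum_congr rfl fun u _ => ?_
    by_cases h : F u = 0 <;> simp [h]
  -- With `β = 1 + 1/(2k)` the requirement `(k - 1)β + 1/2` equals `k - 1/(2k)`, just below the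
  -- total mass `k`.
  obtain ⟨T, hTA, hT, hTm⟩ := exists_disjoint_groups
    (fun a => ∑ u ∈ X with p u = a, G.degree u * ‖F u‖ ^ 2) (β := 1 + 1 / (2 * k))
    (by simp) (fun a => G.sum_degree_mul_norm_sq_le_of_dist_le F hk hF _
      (fun u hu => (Finset.mem_filter.1 (Finset.mem_filter.1 hu).1).2)
      (fun u hu v hv => by
        rw [Finset.mem_filter] at hu hv
        exact hp u hu.1 v hv.1 (hu.2.trans hv.2.symm))) k (X.image p) (by
      rw [hfib, Finset.filter_true_of_mem fun u hu => Finset.mem_image_of_mem p hu, hXM]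
      have : ((k : ℝ) - 1) * (1 + 1 / (2 * k)) = k - 1 + 1 / 2 - 1 / (2 * k) := by
        field_simp; ring
      rw [this]
      have : 0 < 1 / (2 * (k : ℝ)) := by positivity
      linarith)
  simp only [hfib] at hTm
  have hgroup (i : Fin k) : ∃ S : Finset V, S.Nonempty ∧ (∀ u ∈ S, p u ∈ T i) ∧
      G.expansion S ≤ 291 * (k : ℝ) ^ 2 * √l := by
    set g : V → ℝ := fun u => if u ∈ X ∧ p u ∈ T i then ‖F u‖ ^ 2 else 0 with hg
    have hg0 (u : V) : 0 ≤ g u := by simp only [hg]; split_ifs <;> positivity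
    have hgm : 1 / 2 ≤ ∑ u, G.degree u * g u := by
      refine (hTm i).trans_eq ?_
      rw [Finset.sum_filter, ← Finset.sum_filter_add_sum_filter_not Finset.univ (· ∈ X)]
      rw [Finset.sum_eq_zero (s := Finset.univ.filter (· ∉ X)), add_zero,
        Finset.filter_mem_eq_inter, Finset.univ_inter]
      · refine Finset.sum_congr rfl fun u hu => ?_
        simp [hg, hu]
      · intro u hu
        simp [hg, (Finset.mem_filter.1 hu).2]
    have hgpos : ∃ u, 0 < g u := by
      by_contra! h
      have : ∑ u, G.degree u * g u = 0 := Finset.sum_eq_zero fun u _ => by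
        rw [le_antisymm (h u) (hg0 u), mul_zero]
      linarith
    -- If only `u` is kept, `‖F u‖² ≤ ‖F u‖‖F v‖ + ‖F u‖‖F u - F v‖`. The product is needed only
    -- across different pieces, since groups are unions of pieces, and vanishes when `v ∉ X`.
    have hpt (u v : V) : |g u - g v| ≤ (‖F u‖ + ‖F v‖) * ‖F u - F v‖ +
        (if u ∈ X ∧ v ∈ X then (‖F u‖ * ‖F v‖) * (if p u = p v then 0 else 1) else 0) := by
      have hsub := abs_norm_sq_sub_norm_sq_le (F u) (F v)
      have hXn (w : V) (hw : w ∉ X) : F w = 0 := by simpa [hX] using hw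
      have hextra : 0 ≤ (if u ∈ X ∧ v ∈ X then
          (‖F u‖ * ‖F v‖) * (if p u = p v then (0 : ℝ) else 1) else 0) := by
        split_ifs <;> simp; positivity
      have hn1 : 0 ≤ (‖F u‖ + ‖F v‖) * ‖F u - F v‖ := by positivity
      have habs := abs_le.1 (abs_norm_sub_norm_le (F u) (F v))
      by_cases hu : u ∈ X ∧ p u ∈ T i <;> by_cases hv : v ∈ X ∧ p v ∈ T i
      · simp only [hg, if_pos hu, if_pos hv]
        linarith
      · simp only [hg, if_pos hu, if_neg hv, sub_zero, abs_of_nonneg (sq_nonneg ‖F u‖)]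
        by_cases hvX : v ∈ X
        · have hpne : p u ≠ p v := fun h => hv ⟨hvX, h ▸ hu.2⟩
          rw [if_pos ⟨hu.1, hvX⟩, if_neg hpne]
          nlinarith [norm_nonneg (F u), norm_nonneg (F v), norm_nonneg (F u - F v)]
        · simp [hXn v hvX, hvX, sq]
      · simp only [hg, if_pos hv, if_neg hu, zero_sub, abs_neg, abs_of_nonneg (sq_nonneg ‖F v‖)]
        by_cases huX : u ∈ X
        · have hpne : p u ≠ p v := fun h => hu ⟨huX, h ▸ hv.2⟩
          rw [if_pos ⟨huX, hv.1⟩, if_neg hpne]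
          nlinarith [norm_nonneg (F u), norm_nonneg (F v), norm_nonneg (F u - F v)]
        · simp [hXn u huX, huX, sq]
      · simp only [hg, if_neg hu, if_neg hv, sub_zero, abs_zero]
        linarith
    have hgE : ∑ u, ∑ v, G.weight u v * |g u - g v| ≤ 291 * (k : ℝ) ^ 2 * √l := by
      calc ∑ u, ∑ v, G.weight u v * |g u - g v|
          ≤ ∑ u, ∑ v, (G.weight u v * ((‖F u‖ + ‖F v‖) * ‖F u - F v‖) +
              (if u ∈ X ∧ v ∈ X then
                G.weight u v * (‖F u‖ * ‖F v‖) * (if p u = p v then 0 else 1) else 0)) := by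
            refine Finset.sum_le_sum fun u _ => Finset.sum_le_sum fun v _ => ?_
            refine (mul_le_mul_of_nonneg_left (hpt u v) (G.weight_nonneg u v)).trans_eq ?_
            rw [mul_add, mul_ite, mul_zero, ← mul_assoc (G.weight u v) (‖F u‖ * ‖F v‖)]
        _ = W + ∑ u ∈ X, ∑ v ∈ X,
              G.weight u v * (‖F u‖ * ‖F v‖) * (if p u = p v then 0 else 1) := by
            simp only [Finset.sum_add_distrib]
            congr 1
            rw [← Finset.sum_filter_add_sum_filter_not Finset.univ (· ∈ X)]
            rw [Finset.sum_eq_zero (s := Finset.univ.filter (· ∉ X)), add_zero,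
              Finset.filter_mem_eq_inter, Finset.univ_inter]
            · refine Finset.sum_congr rfl fun u hu => ?_
              simp only [hu, true_and]
              rw [← Finset.sum_filter, Finset.filter_mem_eq_inter, Finset.univ_inter]
            · intro u hu
              simp [(Finset.mem_filter.1 hu).2]
        _ ≤ W + 96 * k * W := by gcongr
        _ = (1 + 96 * k) * W := by ring
        _ ≤ (97 * k) * (3 * k * √l) := by
            refine mul_le_mul (by linarith) hW ?_ (by positivity)
            exact Finset.sum_nonneg fun u _ => Finset.sum_nonneg fun v _ =>
              mul_nonneg (G.weight_nonneg u v) (by positivity)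
        _ = _ := by ring
    -- Mass at least `1/2` cancels the factor `2` in the sweep hypothesis; `291 = 97 · 3`.
    obtain ⟨S, hS, hSg, hSe⟩ := G.exists_expansion_le g hg0 hgpos
      (A := 291 * (k : ℝ) ^ 2 * √l) (hgE.trans (by
        have : 0 ≤ 291 * (k : ℝ) ^ 2 * √l := by positivity
        nlinarith))
    refine ⟨S, hS, fun u hu => ?_, hSe⟩
    have := hSg u hu
    simp only [hg] at this
    by_contra h
    simp [h] at this
  choose S hS hST hSe using hgroup
  refine ⟨S, hS, fun i j hij => ?_, hSe⟩
  exact Finset.disjoint_left.2 fun u hu hv => Finset.disjoint_left.1 (hT hij) (hST i u hu) (hST j u hv)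

end Embedding

theorem kWayExpansion_le (G : WeightedGraph V) (k : ℕ) (hk₁ : 1 ≤ k)
    (hk₂ : k ≤ Fintype.card V) :
    G.kWayExpansion k ≤ 291 * (k : ℝ) ^ 2 * √(G.lam k hk₁ hk₂) := by
  have hE := G.sum_weight_mul_norm_sub_sq_le k hk₁ hk₂
  have hk' : (0 : ℝ) < k := by exact_mod_cast hk₁
  have hl : 0 ≤ G.lam k hk₁ hk₂ := by
    have : 0 ≤ 2 * k * G.lam k hk₁ hk₂ := le_trans (Finset.sum_nonneg fun u _ =>
      Finset.sum_nonneg fun v _ => mul_nonneg (G.weight_nonneg u v) (sq_nonneg _)) hE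
    exact nonneg_of_mul_nonneg_right this (by positivity)
  obtain ⟨S, hne, hS, hSe⟩ := G.exists_disjoint_expansion_le _ hk₁
    (G.sum_degree_mul_inner_spectralEmbedding_sq k hk₂) hl hE
  have : Nonempty (Fin k) := ⟨⟨0, hk₁⟩⟩
  exact (ciInf_le (Set.finite_range _).bddBelow (⟨S, hne, hS⟩ : DisjointFamily V k)).trans
    (ciSup_le hSe)

end WeightedGraph

theorem theorem1 :
    ∃ C : ℝ, 0 < C ∧
      ∀ (V : Type u) [Fintype V] [DecidableEq V] (G : WeightedGraph V) (k : ℕ)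
        (hk₁ : 1 ≤ k) (hk₂ : k ≤ Fintype.card V),
        G.lam k hk₁ hk₂ / 2 ≤ G.kWayExpansion k ∧
          G.kWayExpansion k ≤ C * (k : ℝ) ^ 2 * Real.sqrt (G.lam k hk₁ hk₂) :=
  ⟨291, by norm_num, fun _ _ _ G k hk₁ hk₂ =>
    ⟨G.lam_le_kWayExpansion k hk₁ hk₂, G.kWayExpansion_le k hk₁ hk₂⟩⟩
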